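/- Let $d_A,d_B,r\ge 1$ be integers. Write $\|X\|_1=\operatorname{Tr}\sqrt{X^\dagger X}$ and $\|X\|_2=\sqrt{\operatorname{Tr}X^\dagger X}$. The Choi state of a channel $\Phi:\mathcal L(\mathbb C^{d_A})\to\mathcal L(\mathbb C^{d})$ is $J_\Phi=(\mathrm{Id}\otimes\Phi)(|\Psi\rangle\langle\Psi|)$ with $|\Psi\rangle=d_A^{-1/2}\sum_{i=1}^{d_A}|i\rangle\otimes|i\rangle$. Let $E=\mathbb C^r$, $B=\mathbb C^{d_B}$, $F=\mathbb C^2$, and identify $E\otimes B$ with $\mathbb C^{rd_B}$ by the lexicographic order of the product basis. To every unitary $U\in\mathrm U(rd_B)$ associate a channel $\Phi_U(X)=\operatorname{Tr}_E[V_UXV_U^\dagger]$ by one of the following two constructions. (1) $d_A=rd_B$. Let $\theta\in(\pi/2,\pi]$, $\varepsilon=-2\cos\theta$, and $O=\varepsilon\,\mathrm{diag}(e^{i\theta},e^{-i\theta},\dots,e^{i\theta},e^{-i\theta})$ if $d_A$ is even, $O=\varepsilon\,\mathrm{diag}(e^{i\theta},e^{-i\theta},\dots,e^{i\theta},e^{-i\theta},0)$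 if $d_A$ is odd. Put $V_U=U(\mathbb 1+O)U^\dagger$. (2) $d_A\le rd_B/2$. Let $0<\varepsilon\le 1$, let $K_1,\dots,K_r\in\mathbb C^{d_B\times d_A}$ be any Kraus operators of a channel ($\sum_iK_i^\dagger K_i=\mathbb 1$) such that $|\operatorname{Tr}[K_i^\dagger K_j]|\le\frac{2d_A}{r}\delta_{ij}$ for all $i,j$, and put $\widetilde V_0=\sum_{i=1}^r|i\rangle_E\otimes K_i$, $S=\sum_{i=1}^{d_A}|i\rangle_{BE}\langle i|_A$. Put $V_U=\sqrt{1-\varepsilon^2}\,|0\rangle_F\otimes\widetilde V_0+\varepsilon\,|1\rangle_F\otimes US$. In either case let $f(U_1,U_2)=\|J_{\Phi_{U_1}}-J_{\Phi_{U_2}}\|_1$ on $\mathrm U(rd_B)^2$. Then: (a) In both constructions, for all $U_1,U_2,U_1',U_2'\in\mathrm U(rd_B)$, $$|f(U_1,U_2)-f(U_1',U_2')|\le 4\sqrt{\tfrac{2}{d_A}}\;\varepsilon\,\sqrt{\|U_1-U_1'\|_2^2+\|U_2-U_2'\|_2^2}.$$ (b) There is a universal constant $c>0$ (independent of $d_A,d_B,r,\varepsilon$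 and of the $K_i$) such that, whenever $\varepsilon<10^{-4}$, and with $d_B\ge 2$ in construction (1), independent Haar-random $U_1,U_2\in\mathrm U(rd_B)$ satisfy $$\mathbb E\,\|J_{\Phi_{U_1}}-J_{\Phi_{U_2}}\|_1\ge c\,\varepsilon.$$ -/

import Mathlib

open scoped Matrix MatrixOrder

namespace RandomChannel

/-! ### Norms -/

/-- The trace norm `‖X‖₁ = Tr √(X†X)`. -/
noncomputable def traceNorm {n : Type*} [Fintype n] [DecidableEq n] (X : Matrix n n ℂ) : ℝ :=
  (CFC.sqrt (Xᴴ * X)).trace.re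

/-- The Hilbert–Schmidt norm `‖X‖₂ = √(Tr (X†X))`. -/
noncomputable def hsNorm {n : Type*} [Fintype n] (X : Matrix n n ℂ) : ℝ :=
  Real.sqrt (Xᴴ * X).trace.re

/-! ### Channels and Choi states -/

/-- The partial trace over the first tensor factor `E` of an operator on `E ⊗ B`. -/
def partialTraceEnv {e b : Type*} [Fintype e] (X : Matrix (e × b) (e × b) ℂ) : Matrix b b ℂ :=
  Matrix.of fun y y' => ∑ i, X (i, y) (i, y')

/-- The linear map `X ↦ Tr_E (V X V†)` with Stinespring operator `V : A → E ⊗ B`. -/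
noncomputable def stinespringMap {a b e : Type*} [Fintype a] [Fintype e]
    (V : Matrix (e × b) a ℂ) : Matrix a a ℂ → Matrix b b ℂ :=
  fun X => partialTraceEnv (V * X * Vᴴ)

/-- The map `Id_{A'} ⊗ Φ`, acting as `Φ` on each block `(⟨x| ⊗ 1) Y (|x'⟩ ⊗ 1)` of `Y`. -/
def idTensor {a' a b : Type*} (Φ : Matrix a a ℂ → Matrix b b ℂ)
    (Y : Matrix (a' × a) (a' × a) ℂ) : Matrix (a' × b) (a' × b) ℂ :=
  Matrix.of fun p q => Φ (Matrix.of fun x x' => Y (p.1, x) (q.1, x')) p.2 q.2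

/-- The normalised maximally entangled vector `d_A^{-1/2} ∑ᵢ |i⟩ ⊗ |i⟩`. -/
noncomputable def maxEntangled (a : Type*) [Fintype a] [DecidableEq a] : a × a → ℂ :=
  fun p => if p.1 = p.2 then ((1 / Real.sqrt (Fintype.card a) : ℝ) : ℂ) else 0

/-- The Choi state `J_Φ = (Id_{A'} ⊗ Φ)(|Ψ⟩⟨Ψ|)`. -/
noncomputable def choiState {a b : Type*} [Fintype a] [DecidableEq a]
    (Φ : Matrix a a ℂ → Matrix b b ℂ) : Matrix (a × b) (a × b) ℂ :=
  idTensor Φ (Matrix.vecMulVec (maxEntangled a) (star (maxEntangled a)))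

/-- The trace distance `‖J_{Φ₁} - J_{Φ₂}‖₁` between the Choi states of the channels
`Φᵢ(X) = Tr_E (Vᵢ X Vᵢ†)`. -/
noncomputable def choiDist {a b e : Type*} [Fintype a] [DecidableEq a] [Fintype b]
    [DecidableEq b] [Fintype e] (V₁ V₂ : Matrix (e × b) a ℂ) : ℝ :=
  traceNorm (choiState (stinespringMap V₁) - choiState (stinespringMap V₂))

/-! ### First construction: `d_A = r d_B`

The basis of `E ⊗ B` is identified with that of `ℂ^{r d_B}` by the lexicographic bijection
`finProdFinEquiv : Fin r × Fin dB ≃ Fin (r * dB)`. -/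

/-- `ε · diag(e^{iθ}, e^{-iθ}, …, e^{iθ}, e^{-iθ})`, with a last entry `0` if `d` is odd. -/
noncomputable def phaseDiag (d : ℕ) (ε θ : ℝ) : Matrix (Fin d) (Fin d) ℂ :=
  Matrix.diagonal fun k =>
    if Odd d ∧ (k : ℕ) + 1 = d then 0
    else if Even (k : ℕ) then (ε : ℂ) * Complex.exp (Complex.I * θ)
    else (ε : ℂ) * Complex.exp (-(Complex.I * θ))

/-- `V = U (1 + O) U†`, as an operator `A → E ⊗ B` where `A ≅ ℂ^{r d_B} ≅ E ⊗ B`. -/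
noncomputable def conjIsometry (r dB : ℕ) (ε θ : ℝ)
    (U : Matrix.unitaryGroup (Fin (r * dB)) ℂ) :
    Matrix (Fin r × Fin dB) (Fin (r * dB)) ℂ :=
  ((U : Matrix (Fin (r * dB)) (Fin (r * dB)) ℂ) * (1 + phaseDiag (r * dB) ε θ) *
    (U : Matrix (Fin (r * dB)) (Fin (r * dB)) ℂ)ᴴ).submatrix finProdFinEquiv id

/-! ### Second construction: `d_A ≤ r d_B / 2` -/

/-- `K₁, …, K_r` are Kraus operators of a quantum channel `ℂ^{d_A} → ℂ^{d_B}` and satisfy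
`|Tr (Kᵢ† Kⱼ)| ≤ (2 d_A / r) δᵢⱼ`. -/
structure IsBalancedKraus {dA dB r : ℕ} (K : Fin r → Matrix (Fin dB) (Fin dA) ℂ) : Prop where
  complete : ∑ i, (K i)ᴴ * K i = 1
  trace_le : ∀ i j, ‖((K i)ᴴ * K j).trace‖ ≤ if i = j then 2 * (dA : ℝ) / r else 0

/-- `Ṽ₀ = ∑ᵢ |i⟩_E ⊗ Kᵢ : A → E ⊗ B`. -/
def krausIsometry {dA dB r : ℕ} (K : Fin r → Matrix (Fin dB) (Fin dA) ℂ) :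
    Matrix (Fin r × Fin dB) (Fin dA) ℂ :=
  Matrix.of fun p x => K p.1 p.2 x

/-- `S = ∑ᵢ |i⟩⟨i| : ℂ^{d_A} → ℂ^N`, the sum running over the basis of `ℂ^{d_A}`. -/
def embedFirst (N dA : ℕ) : Matrix (Fin N) (Fin dA) ℂ :=
  Matrix.of fun y x => if (y : ℕ) = (x : ℕ) then 1 else 0

/-- `Ṽ = U S : A → E ⊗ B`. -/
noncomputable def haarIsometry (dA dB r : ℕ) (U : Matrix.unitaryGroup (Fin (r * dB)) ℂ) :
    Matrix (Fin r × Fin dB) (Fin dA) ℂ :=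
  ((U : Matrix (Fin (r * dB)) (Fin (r * dB)) ℂ) * embedFirst (r * dB) dA).submatrix
    finProdFinEquiv id

/-- `V = √(1 - ε²) |0⟩_F ⊗ Ṽ₀ + ε |1⟩_F ⊗ U S : A → E ⊗ (F ⊗ B)` with `F = ℂ²`. -/
noncomputable def flagIsometry {dA dB r : ℕ} (K : Fin r → Matrix (Fin dB) (Fin dA) ℂ) (ε : ℝ)
    (U : Matrix.unitaryGroup (Fin (r * dB)) ℂ) :
    Matrix (Fin r × (Fin 2 × Fin dB)) (Fin dA) ℂ :=
  Matrix.of fun p x =>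
    if p.2.1 = 0 then ((Real.sqrt (1 - ε ^ 2) : ℝ) : ℂ) * krausIsometry K (p.1, p.2.2) x
    else (ε : ℂ) * haarIsometry dA dB r U (p.1, p.2.2) x

/-! ### Haar measure on the unitary group -/

noncomputable instance measurableSpaceUnitaryGroup (n : ℕ) :
    MeasurableSpace (Matrix.unitaryGroup (Fin n) ℂ) := borel _

instance borelSpaceUnitaryGroup (n : ℕ) : BorelSpace (Matrix.unitaryGroup (Fin n) ℂ) := ⟨rfl⟩

instance compactSpaceUnitaryGroup (n : ℕ) : CompactSpace (Matrix.unitaryGroup (Fin n) ℂ) := by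
  have hK : IsCompact (Set.pi Set.univ fun _ : Fin n =>
      Set.pi Set.univ fun _ : Fin n => Metric.closedBall (0 : ℂ) 1) :=
    isCompact_univ_pi fun _ => isCompact_univ_pi fun _ => isCompact_closedBall _ _
  have hU : IsCompact (Matrix.unitaryGroup (Fin n) ℂ : Set (Matrix (Fin n) (Fin n) ℂ)) := by
    refine IsCompact.of_isClosed_subset hK isClosed_unitary ?_
    intro U hU i _ j _
    rw [mem_closedBall_zero_iff]
    exact entry_norm_bound_of_unitary hU i j
  exact isCompact_iff_compactSpace.mp hU

/-- The Haar probability measure on `U(n)`. -/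
noncomputable def haarU (n : ℕ) : MeasureTheory.Measure (Matrix.unitaryGroup (Fin n) ℂ) :=
  MeasureTheory.Measure.haarMeasure ⊤

end RandomChannel

open RandomChannel MeasureTheory

/-!
Writing `V|Ψ⟩` as a matrix `M` with rows indexed by `A ⊗ B` and columns by `E` (`choiFactor`), the
Choi state of the channel with Stinespring operator `V` is `M M†` (`choiState_stinespringMap`), and
`‖M‖₂ = 1` when `V` is an isometry. All trace norms below are of Hermitian matrices `X`, for which
`‖X‖₁` is the maximum of `Re Tr (W X)` over contractions `W`
(`re_trace_mul_le_traceNorm`, `exists_re_trace_mul_eq_traceNorm`).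

*Lipschitz bound.* By duality and Cauchy–Schwarz, `‖MM† - M'M'†‖₁ ≤ 2 ‖M - M'‖₂`, which is
`2 d_A^{-1/2} ‖V - V'‖₂`. In both constructions `‖V_U - V_U'‖₂ ≤ 2 ε ‖U - U'‖₂`, since
`U O U† - U' O U'†` is the sum of `(U - U') O U†` and `U' O (U - U')†` with `‖O‖ ≤ ε`.

*Lower bound on the mean.* For fixed `U₁`, the trace norm is bounded below by the pairing with a
contraction `W` that depends on `U₁` only. The part of the pairing linear in `U₂` then averages to
zero, so that `𝔼 f` is bounded below by the mean of a function of `U₁` alone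
(`integral_le_integral_prod_haarU`). What is left are second moments of `U O U†`. Invariance of the
Haar measure under diagonal phases, permutations and the rotation `(1 + iP)/√2` determines them, and
they give the exact mean of `‖Tr_B (U O U†)‖₂²` (`integral_frob_traceOutB`).

In the first construction `M = K + q`, where `K` and `q` come from `1` and `U O U†`. The projection
`1 - r K K†` removes `K`, and `W = (r/ε) K q₁† (1 - r K K†)` is a contraction because
`‖q₁‖ ≤ ε / √r`. Up to terms of order `ε²`, which come from `q q†`, the pairing is
`(‖q₁‖₂² - r ‖K† q₁‖₂²) / ε`, where `K† q₁` is the transpose of the partial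
trace of `U₁ O U₁†`, divided by `d_A`.

In the second construction, the off-diagonal block of the Choi state with respect to the flag `F` is
`ε √(1 - ε²) K u†`, with `K` and `u` the reshaped Kraus isometry and the reshaped `U S`. The trace
norm of `Y = K u₁†` is bounded below by second and fourth moments of its singular values, through
`x ≥ 3x²/(2s) - x⁴/(2s³)` with `s = 4/r` (`exists_contraction_moment_le`). Orthogonality of the
Kraus operators reduces `Tr (Y†Y)²` to the purity of the reduced state of `U₁ S` on `E`.
-/

set_option linter.unusedSectionVars false

namespace RandomChannel

/-! ### The Hilbert–Schmidt norm of rectangular matrices -/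

section Frob

variable {l m n : Type*} [Fintype l] [Fintype m] [Fintype n]

/-- The Hilbert–Schmidt norm of a rectangular matrix. -/
noncomputable def frob (X : Matrix m n ℂ) : ℝ := Real.sqrt (∑ i, ∑ j, ‖X i j‖ ^ 2)

lemma frob_nonneg (X : Matrix m n ℂ) : 0 ≤ frob X := Real.sqrt_nonneg _

lemma frob_sq (X : Matrix m n ℂ) : frob X ^ 2 = ∑ i, ∑ j, ‖X i j‖ ^ 2 :=
  Real.sq_sqrt (Finset.sum_nonneg fun _ _ => Finset.sum_nonneg fun _ _ => by positivity)

lemma frob_eq_norm (X : Matrix m n ℂ) :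
    frob X = ‖WithLp.toLp 2 (fun p : m × n => X p.1 p.2)‖ := by
  rw [EuclideanSpace.norm_eq, frob, Fintype.sum_prod_type]

lemma frob_add_le (X Y : Matrix m n ℂ) : frob (X + Y) ≤ frob X + frob Y := by
  rw [frob_eq_norm, frob_eq_norm, frob_eq_norm]
  exact norm_add_le (WithLp.toLp 2 (fun p : m × n => X p.1 p.2))
    (WithLp.toLp 2 (fun p : m × n => Y p.1 p.2))

lemma frob_smul (c : ℂ) (X : Matrix m n ℂ) : frob (c • X) = ‖c‖ * frob X := by
  rw [frob_eq_norm, frob_eq_norm]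
  exact norm_smul c (WithLp.toLp 2 (fun p : m × n => X p.1 p.2))

lemma frob_conjTranspose (X : Matrix m n ℂ) : frob Xᴴ = frob X := by
  rw [frob, frob, Finset.sum_comm]
  simp

lemma trace_conjTranspose_mul (X : Matrix m n ℂ) : (Xᴴ * X).trace = ((frob X ^ 2 : ℝ) : ℂ) := by
  rw [frob_sq, Finset.sum_comm, Matrix.trace]
  push_cast
  refine Finset.sum_congr rfl fun j _ => ?_
  rw [Matrix.diag_apply, Matrix.mul_apply]
  refine Finset.sum_congr rfl fun i _ => ?_
  rw [Matrix.conjTranspose_apply, RCLike.star_def, Complex.conj_mul']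

lemma hsNorm_eq_frob (X : Matrix n n ℂ) : hsNorm X = frob X := by
  rw [hsNorm, trace_conjTranspose_mul, Complex.ofReal_re, Real.sqrt_sq (frob_nonneg X)]

/-- Cauchy–Schwarz for the Hilbert–Schmidt inner product. -/
lemma norm_trace_mul_le (A : Matrix m n ℂ) (B : Matrix n m ℂ) :
    ‖(A * B).trace‖ ≤ frob A * frob B := by
  have h := norm_inner_le_norm (𝕜 := ℂ) (WithLp.toLp 2 (fun p : m × n => Aᴴ p.2 p.1))
    (WithLp.toLp 2 (fun p : m × n => Bᵀ p.1 p.2))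
  have h1 : (A * B).trace = inner ℂ (WithLp.toLp 2 (fun p : m × n => Aᴴ p.2 p.1))
      (WithLp.toLp 2 (fun p : m × n => Bᵀ p.1 p.2)) := by
    simp [PiLp.inner_apply, Fintype.sum_prod_type, Matrix.trace, Matrix.mul_apply, mul_comm]
  rw [h1]
  refine h.trans (le_of_eq ?_)
  rw [EuclideanSpace.norm_eq, EuclideanSpace.norm_eq, frob, frob, Finset.sum_comm (γ := n),
    Fintype.sum_prod_type, Fintype.sum_prod_type]
  simp

lemma frob_reindex {l' m' : Type*} [Fintype l'] [Fintype m'] (e : l ≃ l') (f : m ≃ m')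
    (X : Matrix l' m' ℂ) : frob (X.submatrix e f) = frob X := by
  rw [frob, frob]
  congr 1
  rw [← e.sum_comp]
  refine Finset.sum_congr rfl fun i _ => ?_
  rw [← f.sum_comp]
  rfl

end Frob

/-! ### Operator norm, trace norm and duality -/

section TraceNorm

variable {n : Type*} [Fintype n] [DecidableEq n]

lemma unitary_conjTranspose_mul_self (V : Matrix.unitaryGroup n ℂ) :
    (V : Matrix n n ℂ)ᴴ * (V : Matrix n n ℂ) = 1 := by
  rw [← Matrix.star_eq_conjTranspose]; exact Unitary.coe_star_mul_self V

lemma unitary_mul_conjTranspose_self (V : Matrix.unitaryGroup n ℂ) :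
    (V : Matrix n n ℂ) * (V : Matrix n n ℂ)ᴴ = 1 := by
  rw [← Matrix.star_eq_conjTranspose]; exact Unitary.coe_mul_star_self V

lemma exists_unitary_diagonalization {X : Matrix n n ℂ} (hX : X.IsHermitian) :
    ∃ (V : Matrix.unitaryGroup n ℂ) (d : n → ℝ),
      X = (V : Matrix n n ℂ) * Matrix.diagonal (fun i => (d i : ℂ)) * (V : Matrix n n ℂ)ᴴ := by
  refine ⟨hX.eigenvectorUnitary, hX.eigenvalues, ?_⟩
  conv_lhs => rw [hX.spectral_theorem, Unitary.conjStarAlgAut_apply]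
  rfl

open scoped ComplexOrder in
lemma traceNorm_conj_diagonal (V : Matrix.unitaryGroup n ℂ) (d : n → ℝ) :
    traceNorm ((V : Matrix n n ℂ) * Matrix.diagonal (fun i => (d i : ℂ)) * (V : Matrix n n ℂ)ᴴ)
      = ∑ i, |d i| := by
  have hV := unitary_conjTranspose_mul_self V
  set R := (V : Matrix n n ℂ) * Matrix.diagonal (fun i => ((|d i| : ℝ) : ℂ)) *
      (V : Matrix n n ℂ)ᴴ with hR
  have hR0 : (0 : Matrix n n ℂ) ≤ R := by
    rw [Matrix.nonneg_iff_posSemidef, hR]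
    refine Matrix.PosSemidef.mul_mul_conjTranspose_same ?_ _
    rw [Matrix.posSemidef_diagonal_iff]
    intro i
    exact_mod_cast abs_nonneg _
  have hsq : R * R = ((V : Matrix n n ℂ) * Matrix.diagonal (fun i => (d i : ℂ)) *
      (V : Matrix n n ℂ)ᴴ)ᴴ * ((V : Matrix n n ℂ) * Matrix.diagonal (fun i => (d i : ℂ)) *
      (V : Matrix n n ℂ)ᴴ) := by
    have hd : (Matrix.diagonal (fun i => (d i : ℂ)))ᴴ = Matrix.diagonal (fun i => (d i : ℂ)) := by
      rw [Matrix.diagonal_conjTranspose]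
      congr 1
      funext i
      simp
    have h3 : ∀ a b c e : Matrix n n ℂ, a * b * c * (a * e * c) = a * (b * (c * a) * e) * c := by
      intros; simp only [mul_assoc]
    rw [Matrix.conjTranspose_mul, Matrix.conjTranspose_mul, Matrix.conjTranspose_conjTranspose, hd,
      ← mul_assoc (V : Matrix n n ℂ), hR, h3, h3, hV]
    simp only [mul_one]
    rw [Matrix.diagonal_mul_diagonal, Matrix.diagonal_mul_diagonal]
    congr 3
    funext i
    exact_mod_cast abs_mul_abs_self _
  rw [traceNorm, CFC.sqrt_unique hsq hR0, hR, Matrix.trace_mul_comm, ← mul_assoc, hV, one_mul,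
    Matrix.trace_diagonal]
  simp

end TraceNorm

section OpNorm

open scoped Matrix.Norms.L2Operator

variable {l m n : Type*} [Fintype l] [Fintype m] [Fintype n]
  [DecidableEq l] [DecidableEq m] [DecidableEq n]

lemma sum_norm_mulVec_sq_le (W : Matrix m n ℂ) (x : n → ℂ) :
    ∑ i, ‖(W *ᵥ x) i‖ ^ 2 ≤ ‖W‖ ^ 2 * ∑ j, ‖x j‖ ^ 2 := by
  have h := Matrix.l2_opNorm_mulVec W (WithLp.toLp 2 x)
  have h2 := mul_self_le_mul_self (norm_nonneg _) h
  rw [← sq, ← sq, mul_pow, EuclideanSpace.norm_sq_eq, EuclideanSpace.norm_sq_eq] at h2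
  exact h2

lemma opNorm_le_of_sum_sq_le (W : Matrix m n ℂ) {c : ℝ} (hc : 0 ≤ c)
    (h : ∀ x : n → ℂ, ∑ i, ‖(W *ᵥ x) i‖ ^ 2 ≤ c ^ 2 * ∑ j, ‖x j‖ ^ 2) : ‖W‖ ≤ c := by
  rw [Matrix.l2_opNorm_def]
  refine ContinuousLinearMap.opNorm_le_bound _ hc fun x => ?_
  refine le_of_sq_le_sq ?_ (by positivity)
  rw [mul_pow, EuclideanSpace.norm_sq_eq, EuclideanSpace.norm_sq_eq]
  exact h x

lemma frob_mul_le (W : Matrix l m ℂ) (X : Matrix m n ℂ) : frob (W * X) ≤ ‖W‖ * frob X := by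
  refine le_of_sq_le_sq ?_ (mul_nonneg (norm_nonneg _) (frob_nonneg _))
  rw [mul_pow, frob_sq, frob_sq, Finset.sum_comm, Finset.sum_comm (γ := m), Finset.mul_sum]
  exact Finset.sum_le_sum fun j _ => sum_norm_mulVec_sq_le W fun i => X i j

lemma frob_mul_le' (X : Matrix l m ℂ) (W : Matrix m n ℂ) : frob (X * W) ≤ frob X * ‖W‖ := by
  have h := frob_mul_le Wᴴ Xᴴ
  rwa [← Matrix.conjTranspose_mul, frob_conjTranspose, frob_conjTranspose,
    Matrix.l2_opNorm_conjTranspose, mul_comm] at h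

lemma opNorm_le_one_of_conjTranspose_mul {V : Matrix m n ℂ} (h : Vᴴ * V = 1) : ‖V‖ ≤ 1 := by
  refine opNorm_le_of_sum_sq_le V zero_le_one fun x => ?_
  have key : ((∑ i, ‖(V *ᵥ x) i‖ ^ 2 : ℝ) : ℂ) = ((∑ j, ‖x j‖ ^ 2 : ℝ) : ℂ) := by
    have h1 : star (V *ᵥ x) ⬝ᵥ (V *ᵥ x) = star x ⬝ᵥ x := by
      rw [Matrix.star_mulVec, ← Matrix.dotProduct_mulVec, Matrix.mulVec_mulVec, h,
        Matrix.one_mulVec]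
    have h2 : ∀ {k : Type _} [Fintype k] (y : k → ℂ),
        star y ⬝ᵥ y = ((∑ j, ‖y j‖ ^ 2 : ℝ) : ℂ) := by
      intro k _ y
      push_cast
      exact Finset.sum_congr rfl fun j _ => by
        rw [Pi.star_apply, RCLike.star_def, Complex.conj_mul']
    have h3 : star (V *ᵥ x) ⬝ᵥ (V *ᵥ x) = ((∑ j, ‖(V *ᵥ x) j‖ ^ 2 : ℝ) : ℂ) := by
      push_cast
      exact Finset.sum_congr rfl fun j _ => by
        rw [Pi.star_apply, RCLike.star_def, Complex.conj_mul']
    rw [← h3, h1, h2]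
  have := Complex.ofReal_injective key
  linarith

lemma norm_entry_le_opNorm (W : Matrix m n ℂ) (i : m) (j : n) : ‖W i j‖ ≤ ‖W‖ := by
  refine le_of_sq_le_sq ?_ (norm_nonneg _)
  have h := sum_norm_mulVec_sq_le W (Pi.single j 1)
  have h1 : ∑ k, ‖(Pi.single j (1 : ℂ) : n → ℂ) k‖ ^ 2 = 1 := by
    rw [Finset.sum_eq_single j] <;> simp +contextual
  rw [h1, mul_one] at h
  refine le_trans ?_ h
  refine le_trans (le_of_eq ?_) (Finset.single_le_sum (f := fun i => ‖(W *ᵥ Pi.single j 1) i‖ ^ 2)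
    (fun i _ => by positivity) (Finset.mem_univ i))
  simp

lemma opNorm_unitary_le (V : Matrix.unitaryGroup n ℂ) : ‖(V : Matrix n n ℂ)‖ ≤ 1 := by
  refine opNorm_le_one_of_conjTranspose_mul ?_
  rw [← Matrix.star_eq_conjTranspose]; exact Unitary.coe_star_mul_self V

lemma opNorm_unitary_conjTranspose_le (V : Matrix.unitaryGroup n ℂ) :
    ‖(V : Matrix n n ℂ)ᴴ‖ ≤ 1 := by
  rw [Matrix.l2_opNorm_conjTranspose]; exact opNorm_unitary_le V

lemma opNorm_mul_le_one {A : Matrix l m ℂ} {B : Matrix m n ℂ} (hA : ‖A‖ ≤ 1) (hB : ‖B‖ ≤ 1) :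
    ‖A * B‖ ≤ 1 :=
  (Matrix.l2_opNorm_mul A B).trans (mul_le_one₀ hA (norm_nonneg _) hB)

lemma opNorm_diagonal_le {v : n → ℂ} {c : ℝ} (hc : 0 ≤ c) (h : ∀ i, ‖v i‖ ≤ c) :
    ‖(Matrix.diagonal v : Matrix n n ℂ)‖ ≤ c := by
  rw [Matrix.l2_opNorm_diagonal]
  exact (pi_norm_le_iff_of_nonneg hc).2 h

/-- The trace norm dominates the pairing with any contraction. -/
lemma re_trace_mul_le_traceNorm {X : Matrix n n ℂ} (hX : X.IsHermitian) {W : Matrix n n ℂ}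
    (hW : ‖W‖ ≤ 1) : (W * X).trace.re ≤ traceNorm X := by
  obtain ⟨V, d, rfl⟩ := exists_unitary_diagonalization hX
  have h1 : (W * ((V : Matrix n n ℂ) * Matrix.diagonal (fun i => (d i : ℂ)) *
      (V : Matrix n n ℂ)ᴴ)).trace =
      ∑ i, ((V : Matrix n n ℂ)ᴴ * W * (V : Matrix n n ℂ)) i i * (d i : ℂ) := by
    rw [← mul_assoc, Matrix.trace_mul_comm, ← mul_assoc, ← mul_assoc, Matrix.trace]
    simp [Matrix.mul_diagonal]
  rw [traceNorm_conj_diagonal, h1, Complex.re_sum]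
  refine Finset.sum_le_sum fun i _ => (Complex.re_le_norm _).trans ?_
  rw [norm_mul, Complex.norm_real, Real.norm_eq_abs]
  refine mul_le_of_le_one_left (abs_nonneg _) ((norm_entry_le_opNorm _ i i).trans ?_)
  exact opNorm_mul_le_one (opNorm_mul_le_one (opNorm_unitary_conjTranspose_le V) hW)
    (opNorm_unitary_le V)

/-- The supremum in the duality formula for the trace norm is attained. -/
lemma exists_re_trace_mul_eq_traceNorm {X : Matrix n n ℂ} (hX : X.IsHermitian) :
    ∃ W : Matrix n n ℂ, ‖W‖ ≤ 1 ∧ (W * X).trace.re = traceNorm X := by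
  obtain ⟨V, d, rfl⟩ := exists_unitary_diagonalization hX
  have hV := unitary_conjTranspose_mul_self V
  refine ⟨(V : Matrix n n ℂ) * Matrix.diagonal (fun i => ((SignType.sign (d i) : ℝ) : ℂ)) *
    (V : Matrix n n ℂ)ᴴ, ?_, ?_⟩
  · refine opNorm_mul_le_one (opNorm_mul_le_one (opNorm_unitary_le V)
      (opNorm_diagonal_le zero_le_one fun i => ?_)) (opNorm_unitary_conjTranspose_le V)
    rw [Complex.norm_real, Real.norm_eq_abs]
    rcases lt_trichotomy (d i) 0 with h | h | h <;> simp [h, sign_neg, sign_pos]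
  · have h3 : ∀ a b c e : Matrix n n ℂ, a * b * c * (a * e * c) = a * (b * (c * a) * e) * c := by
      intros; simp only [mul_assoc]
    rw [traceNorm_conj_diagonal, h3, hV, mul_one, Matrix.trace_mul_comm, ← mul_assoc, hV,
      one_mul, Matrix.diagonal_mul_diagonal, Matrix.trace_diagonal, Complex.re_sum]
    refine Finset.sum_congr rfl fun i _ => ?_
    rw [← Complex.ofReal_mul, Complex.ofReal_re, sign_mul_self]

open scoped ComplexOrder in
/-- A fourth-moment lower bound for the trace norm of a rectangular matrix, in dual form. With
`W = V diag(1/√h) V† Y†`, where `Y†Y = V diag(h) V†`, the pairing `Tr (W Y)` is the sum of the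
singular values `x` of `Y`, and `x ≥ 3x²/(2s) - x⁴/(2s³)`. -/
lemma exists_contraction_moment_le (Y : Matrix m n ℂ) {s : ℝ} (hs : 0 < s) :
    ∃ W : Matrix n m ℂ, ‖W‖ ≤ 1 ∧
      3 / (2 * s) * (Yᴴ * Y).trace.re - 1 / (2 * s ^ 3) * (Yᴴ * Y * (Yᴴ * Y)).trace.re
        ≤ (W * Y).trace.re := by
  have hpsd := Matrix.posSemidef_conjTranspose_mul_self Y
  obtain ⟨V, h, hh⟩ := exists_unitary_diagonalization hpsd.isHermitian
  have hV := unitary_conjTranspose_mul_self V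
  have hVHV : (V : Matrix n n ℂ)ᴴ * (Yᴴ * Y) * (V : Matrix n n ℂ)
      = Matrix.diagonal (fun i => (h i : ℂ)) := by
    have h3 : ∀ a b c : Matrix n n ℂ, c * (a * b * c) * a = (c * a) * b * (c * a) := by
      intros; simp only [mul_assoc]
    rw [hh, h3, hV, one_mul, mul_one]
  have h0 : ∀ i, 0 ≤ h i := by
    have := hpsd.conjTranspose_mul_mul_same (V : Matrix n n ℂ)
    rw [hVHV, Matrix.posSemidef_diagonal_iff] at this
    intro i
    exact_mod_cast this i
  set c : n → ℝ := fun i => (Real.sqrt (h i))⁻¹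
  set D : Matrix n n ℂ := Matrix.diagonal (fun i => (c i : ℂ)) with hD
  have hDD : Dᴴ = D := by
    rw [hD, Matrix.diagonal_conjTranspose]
    congr 1
    funext i
    simp
  refine ⟨(V : Matrix n n ℂ) * D * (V : Matrix n n ℂ)ᴴ * Yᴴ, ?_, ?_⟩
  · -- `‖DV†Y†‖² = ‖D (V†Y†YV) D‖`, and the right-hand side is diagonal with entries `0` or `1`
    have h1 : ‖D * (V : Matrix n n ℂ)ᴴ * Yᴴ‖ ≤ 1 := by
      have h2 := Matrix.l2_opNorm_conjTranspose_mul_self (D * (V : Matrix n n ℂ)ᴴ * Yᴴ)ᴴ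
      have h3 : (D * (V : Matrix n n ℂ)ᴴ * Yᴴ)ᴴᴴ * (D * (V : Matrix n n ℂ)ᴴ * Yᴴ)ᴴ
          = Matrix.diagonal (fun i => ((c i * h i * c i : ℝ) : ℂ)) := by
        simp only [Matrix.conjTranspose_conjTranspose, Matrix.conjTranspose_mul, hDD]
        have : D * (V : Matrix n n ℂ)ᴴ * Yᴴ * (Y * ((V : Matrix n n ℂ) * D))
            = D * ((V : Matrix n n ℂ)ᴴ * (Yᴴ * Y) * (V : Matrix n n ℂ)) * D := by
          simp only [Matrix.mul_assoc]
        rw [this, hVHV, hD, Matrix.diagonal_mul_diagonal, Matrix.diagonal_mul_diagonal]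
        congr 1
        funext i
        push_cast
        rfl
      rw [h3, Matrix.l2_opNorm_conjTranspose] at h2
      have h4 : ‖(Matrix.diagonal (fun i => ((c i * h i * c i : ℝ) : ℂ)) : Matrix n n ℂ)‖ ≤ 1 := by
        refine opNorm_diagonal_le zero_le_one fun i => ?_
        rw [Complex.norm_real, Real.norm_eq_abs]
        rcases (h0 i).eq_or_lt with h5 | h5
        · simp [← h5]
        · have h6 : c i * h i * c i = 1 := by
            have h7 : Real.sqrt (h i) ≠ 0 := (Real.sqrt_pos.2 h5).ne'
            have h8 : h i = Real.sqrt (h i) * Real.sqrt (h i) := (Real.mul_self_sqrt h5.le).symm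
            simp only [c]
            rw [mul_comm, ← mul_assoc]
            conv_lhs => rw [h8]
            rw [Real.sqrt_mul_self (Real.sqrt_nonneg _)]
            field_simp
          rw [h6, abs_one]
      rw [h2] at h4
      nlinarith [norm_nonneg (D * (V : Matrix n n ℂ)ᴴ * Yᴴ)]
    rw [mul_assoc, Matrix.mul_assoc]
    exact opNorm_mul_le_one (opNorm_unitary_le V) h1
  · have ht1 : (Yᴴ * Y).trace.re = ∑ i, h i := by
      rw [hh, Matrix.trace_mul_comm, ← mul_assoc, hV, one_mul, Matrix.trace_diagonal,
        Complex.re_sum]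
      rfl
    have h3 : ∀ a b c e : Matrix n n ℂ, a * b * c * (a * e * c) = a * (b * (c * a) * e) * c := by
      intros; simp only [mul_assoc]
    have ht2 : (Yᴴ * Y * (Yᴴ * Y)).trace.re = ∑ i, h i ^ 2 := by
      rw [hh, h3, hV, mul_one, Matrix.trace_mul_comm, ← mul_assoc, hV, one_mul,
        Matrix.diagonal_mul_diagonal, Matrix.trace_diagonal, Complex.re_sum]
      refine Finset.sum_congr rfl fun i _ => ?_
      rw [← Complex.ofReal_mul, Complex.ofReal_re, sq]
    have ht3 : ((V : Matrix n n ℂ) * D * (V : Matrix n n ℂ)ᴴ * Yᴴ * Y).trace.re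
        = ∑ i, Real.sqrt (h i) := by
      rw [Matrix.mul_assoc, hh, h3, hV, mul_one, Matrix.trace_mul_comm, ← mul_assoc, hV, one_mul,
        hD, Matrix.diagonal_mul_diagonal, Matrix.trace_diagonal, Complex.re_sum]
      refine Finset.sum_congr rfl fun i _ => ?_
      rw [← Complex.ofReal_mul, Complex.ofReal_re, mul_comm, ← div_eq_mul_inv, Real.div_sqrt]
    rw [ht1, ht2, ht3, Finset.mul_sum, Finset.mul_sum, ← Finset.sum_sub_distrib]
    refine Finset.sum_le_sum fun i _ => ?_
    obtain ⟨x, hx, hxx⟩ : ∃ x : ℝ, 0 ≤ x ∧ h i = x ^ 2 :=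
      ⟨Real.sqrt (h i), Real.sqrt_nonneg _, (Real.sq_sqrt (h0 i)).symm⟩
    rw [hxx, Real.sqrt_sq hx]
    have key : x - (3 / (2 * s) * x ^ 2 - 1 / (2 * s ^ 3) * (x ^ 2) ^ 2)
        = x * ((x - s) ^ 2 * (x + 2 * s)) / (2 * s ^ 3) := by
      field_simp
      ring
    have : 0 ≤ x * ((x - s) ^ 2 * (x + 2 * s)) / (2 * s ^ 3) := by positivity
    linarith

lemma norm_trace_mul_mul_le {W : Matrix m m ℂ} (hW : ‖W‖ ≤ 1) (A B : Matrix m n ℂ) :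
    ‖(W * (A * Bᴴ)).trace‖ ≤ frob A * frob B := by
  rw [← Matrix.mul_assoc]
  refine (norm_trace_mul_le _ _).trans ?_
  rw [frob_conjTranspose]
  refine mul_le_mul_of_nonneg_right ?_ (frob_nonneg _)
  exact (frob_mul_le W A).trans (mul_le_of_le_one_left (frob_nonneg _) hW)

lemma isHermitian_sub_mul_conjTranspose (M N : Matrix m n ℂ) :
    (M * Mᴴ - N * Nᴴ).IsHermitian :=
  (Matrix.isHermitian_mul_conjTranspose_self M).sub (Matrix.isHermitian_mul_conjTranspose_self N)

lemma re_trace_mul_sub_le {W : Matrix m m ℂ} (hW : ‖W‖ ≤ 1) {M M' : Matrix m n ℂ}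
    (hM : frob M ≤ 1) (hM' : frob M' ≤ 1) :
    |(W * (M * Mᴴ)).trace.re - (W * (M' * M'ᴴ)).trace.re| ≤ 2 * frob (M - M') := by
  have h1 : (W * (M * Mᴴ)).trace - (W * (M' * M'ᴴ)).trace
      = (W * ((M - M') * Mᴴ)).trace + (W * (M' * (M - M')ᴴ)).trace := by
    rw [← Matrix.trace_sub, ← Matrix.trace_add, ← Matrix.mul_sub, ← Matrix.mul_add]
    congr 2
    rw [Matrix.conjTranspose_sub, Matrix.sub_mul, Matrix.mul_sub]
    abel
  rw [← Complex.sub_re, h1]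
  refine (Complex.abs_re_le_norm _).trans ((norm_add_le _ _).trans ?_)
  have h2 := norm_trace_mul_mul_le hW (M - M') M
  have h3 := norm_trace_mul_mul_le hW M' (M - M')
  have := frob_nonneg (M - M')
  nlinarith [mul_le_mul_of_nonneg_left hM this, mul_le_mul_of_nonneg_right hM' this]

/-- `(M, N) ↦ ‖MM† - NN†‖₁` is `2`-Lipschitz in each argument on the Hilbert–Schmidt unit ball. -/
lemma abs_traceNorm_sub_le {M N M' N' : Matrix m n ℂ} (hM : frob M ≤ 1) (hN : frob N ≤ 1)
    (hM' : frob M' ≤ 1) (hN' : frob N' ≤ 1) :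
    |traceNorm (M * Mᴴ - N * Nᴴ) - traceNorm (M' * M'ᴴ - N' * N'ᴴ)|
      ≤ 2 * frob (M - M') + 2 * frob (N - N') := by
  have key : ∀ {M N M' N' : Matrix m n ℂ}, frob M ≤ 1 → frob N ≤ 1 → frob M' ≤ 1 → frob N' ≤ 1 →
      traceNorm (M * Mᴴ - N * Nᴴ) - traceNorm (M' * M'ᴴ - N' * N'ᴴ)
        ≤ 2 * frob (M - M') + 2 * frob (N - N') := by
    intro M N M' N' hM hN hM' hN'
    obtain ⟨W, hW, hWe⟩ :=
      exists_re_trace_mul_eq_traceNorm (isHermitian_sub_mul_conjTranspose M N)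
    have h1 := re_trace_mul_le_traceNorm (isHermitian_sub_mul_conjTranspose M' N') hW
    rw [Matrix.mul_sub, Matrix.trace_sub, Complex.sub_re] at h1 hWe
    have h2 := abs_le.1 (re_trace_mul_sub_le hW hM hM')
    have h3 := abs_le.1 (re_trace_mul_sub_le hW hN hN')
    linarith [h2.2, h3.1]
  have hsymm : ∀ A B : Matrix m n ℂ, frob (A - B) = frob (B - A) := by
    intro A B
    rw [← neg_sub, ← neg_one_smul ℂ (B - A), frob_smul]
    simp
  rw [abs_le]
  constructor
  · have := key hM' hN' hM hN
    rw [hsymm M', hsymm N'] at this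
    linarith
  · exact key hM hN hM' hN'

end OpNorm

/-! ### Choi states of Stinespring channels -/

section Choi

variable {a b e : Type*} [Fintype a] [DecidableEq a] [Fintype b] [DecidableEq b] [Fintype e]

/-- The reshaped Stinespring operator `A ⊗ B ← E` of `V : A → E ⊗ B`, with entries
`d_A^{-1/2} ⟨i, y| V |x⟩` in row `(x, y)` and column `i`: its `i`-th column is the vector
`(1 ⊗ ⟨i|_E V) |Ψ⟩`. -/
noncomputable def choiFactor (V : Matrix (e × b) a ℂ) : Matrix (a × b) e ℂ :=
  Matrix.of fun p i => ((1 / Real.sqrt (Fintype.card a) : ℝ) : ℂ) * V (i, p.2) p.1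

lemma choiFactor_apply (V : Matrix (e × b) a ℂ) (p : a × b) (i : e) :
    choiFactor V p i = ((1 / Real.sqrt (Fintype.card a) : ℝ) : ℂ) * V (i, p.2) p.1 := rfl

lemma choiState_stinespringMap (V : Matrix (e × b) a ℂ) :
    choiState (stinespringMap V) = choiFactor V * (choiFactor V)ᴴ := by
  ext ⟨x, y⟩ ⟨x', y'⟩
  simp only [choiState, idTensor, stinespringMap, partialTraceEnv, Matrix.of_apply,
    Matrix.mul_apply, Matrix.conjTranspose_apply, choiFactor_apply, Matrix.vecMulVec_apply,
    maxEntangled, Pi.star_apply]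
  refine Finset.sum_congr rfl fun i _ => ?_
  rw [Finset.sum_eq_single x', Finset.sum_eq_single x]
  · simp
    ring
  · intro t _ ht
    simp [ht.symm]
  · simp
  · intro t _ ht
    simp [ht.symm]
  · simp

lemma choiDist_eq (V₁ V₂ : Matrix (e × b) a ℂ) :
    choiDist V₁ V₂ = traceNorm (choiFactor V₁ * (choiFactor V₁)ᴴ
      - choiFactor V₂ * (choiFactor V₂)ᴴ) := by
  rw [choiDist, choiState_stinespringMap, choiState_stinespringMap]

lemma choiFactor_sub (V V' : Matrix (e × b) a ℂ) :
    choiFactor V - choiFactor V' = choiFactor (V - V') := by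
  ext p i
  simp [choiFactor_apply, mul_sub]

lemma frob_choiFactor (V : Matrix (e × b) a ℂ) :
    frob (choiFactor V) = 1 / Real.sqrt (Fintype.card a) * frob V := by
  have h0 : (0 : ℝ) ≤ 1 / Real.sqrt (Fintype.card a) := by positivity
  refine (sq_eq_sq₀ (frob_nonneg _) (mul_nonneg h0 (frob_nonneg _))).1 ?_
  rw [mul_pow, frob_sq, frob_sq, Fintype.sum_prod_type, Fintype.sum_prod_type]
  simp only [choiFactor_apply, norm_mul, mul_pow, Complex.norm_real, Real.norm_eq_abs, sq_abs,
    ← Finset.mul_sum]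
  congr 1
  calc _ = ∑ x, ∑ i, ∑ y, ‖V (i, y) x‖ ^ 2 := Finset.sum_congr rfl fun x _ => Finset.sum_comm
    _ = ∑ i, ∑ x, ∑ y, ‖V (i, y) x‖ ^ 2 := Finset.sum_comm
    _ = _ := Finset.sum_congr rfl fun i _ => Finset.sum_comm

lemma frob_choiFactor_of_isometry {V : Matrix (e × b) a ℂ} (hV : Vᴴ * V = 1) :
    frob (choiFactor V) ≤ 1 := by
  have h := trace_conjTranspose_mul V
  rw [hV, Matrix.trace_one] at h
  have h1 : (Fintype.card a : ℝ) = frob V ^ 2 := by exact_mod_cast h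
  rw [frob_choiFactor, h1, Real.sqrt_sq (frob_nonneg V), one_div]
  exact inv_mul_le_one

/-- Lipschitz bound for the trace distance of Choi states in terms of the isometries. -/
lemma abs_choiDist_sub_le {V₁ V₂ V₁' V₂' : Matrix (e × b) a ℂ} (h₁ : V₁ᴴ * V₁ = 1)
    (h₂ : V₂ᴴ * V₂ = 1) (h₁' : V₁'ᴴ * V₁' = 1) (h₂' : V₂'ᴴ * V₂' = 1) :
    |choiDist V₁ V₂ - choiDist V₁' V₂'|
      ≤ 2 * (1 / Real.sqrt (Fintype.card a)) * (frob (V₁ - V₁') + frob (V₂ - V₂')) := by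
  classical
  rw [choiDist_eq, choiDist_eq]
  refine (abs_traceNorm_sub_le (frob_choiFactor_of_isometry h₁) (frob_choiFactor_of_isometry h₂)
    (frob_choiFactor_of_isometry h₁') (frob_choiFactor_of_isometry h₂')).trans (le_of_eq ?_)
  rw [choiFactor_sub, choiFactor_sub, frob_choiFactor, frob_choiFactor]
  ring

end Choi

/-- Both constructions satisfy `‖V_U - V_U'‖₂ ≤ 2 ε ‖U - U'‖₂`; this turns such a bound into the
Lipschitz estimate for the trace distance. -/
lemma choiDist_lipschitz_of_isometry {a b e : Type*} [Fintype a] [DecidableEq a] [Fintype b]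
    [DecidableEq b] [Fintype e] {N : ℕ} {ε : ℝ} (hε : 0 ≤ ε)
    (V : Matrix.unitaryGroup (Fin N) ℂ → Matrix (e × b) a ℂ) (hV : ∀ U, (V U)ᴴ * V U = 1)
    (hL : ∀ U U', frob (V U - V U') ≤ 2 * ε * frob (U.1 - U'.1))
    (U₁ U₂ U₁' U₂' : Matrix.unitaryGroup (Fin N) ℂ) :
    |choiDist (V U₁) (V U₂) - choiDist (V U₁') (V U₂')|
      ≤ 4 * Real.sqrt (2 / (Fintype.card a : ℝ)) * ε *
        Real.sqrt (hsNorm (U₁.1 - U₁'.1) ^ 2 + hsNorm (U₂.1 - U₂'.1) ^ 2) := by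
  rw [hsNorm_eq_frob, hsNorm_eq_frob]
  set x := frob (U₁.1 - U₁'.1)
  set y := frob (U₂.1 - U₂'.1)
  have hx : 0 ≤ x := frob_nonneg _
  have hy : 0 ≤ y := frob_nonneg _
  have hxy : x + y ≤ Real.sqrt 2 * Real.sqrt (x ^ 2 + y ^ 2) := by
    rw [← Real.sqrt_mul (by norm_num)]
    refine Real.le_sqrt_of_sq_le ?_
    nlinarith [sq_nonneg (x - y)]
  have h0 : (0 : ℝ) ≤ 1 / Real.sqrt (Fintype.card a) := by positivity
  calc _ ≤ 2 * (1 / Real.sqrt (Fintype.card a)) * (frob (V U₁ - V U₁') + frob (V U₂ - V U₂')) :=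
        abs_choiDist_sub_le (hV _) (hV _) (hV _) (hV _)
    _ ≤ 2 * (1 / Real.sqrt (Fintype.card a)) * (2 * ε * x + 2 * ε * y) := by
        gcongr
        · exact hL _ _
        · exact hL _ _
    _ = 4 * (1 / Real.sqrt (Fintype.card a)) * ε * (x + y) := by ring
    _ ≤ 4 * (1 / Real.sqrt (Fintype.card a)) * ε *
          (Real.sqrt 2 * Real.sqrt (x ^ 2 + y ^ 2)) := by gcongr
    _ = _ := by
        rw [Real.sqrt_div (by norm_num)]
        ring

/-! ### The conjugated diagonal unitary -/

/-- The conjugate `U O U†` of a fixed matrix by a unitary. -/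
noncomputable def conjBy {n : Type*} [Fintype n] [DecidableEq n] (O : Matrix n n ℂ)
    (U : Matrix.unitaryGroup n ℂ) : Matrix n n ℂ :=
  (U : Matrix n n ℂ) * O * (U : Matrix n n ℂ)ᴴ

section Conj

open scoped Matrix.Norms.L2Operator

variable {n : Type*} [Fintype n] [DecidableEq n]

lemma frob_conjBy_sub_le (O : Matrix n n ℂ) (U U' : Matrix.unitaryGroup n ℂ) :
    frob (conjBy O U - conjBy O U') ≤ 2 * ‖O‖ * frob (U.1 - U'.1) := by
  have h : conjBy O U - conjBy O U' = (U.1 - U'.1) * (O * U.1ᴴ) + U'.1 * O * (U.1 - U'.1)ᴴ := by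
    rw [conjBy, conjBy, Matrix.conjTranspose_sub]
    noncomm_ring
  have h1 : ‖O * U.1ᴴ‖ ≤ ‖O‖ := (Matrix.l2_opNorm_mul _ _).trans
    (mul_le_of_le_one_right (norm_nonneg _) (opNorm_unitary_conjTranspose_le U))
  have h2 : ‖U'.1 * O‖ ≤ ‖O‖ := (Matrix.l2_opNorm_mul _ _).trans
    (mul_le_of_le_one_left (norm_nonneg _) (opNorm_unitary_le U'))
  have h3 := frob_mul_le' (U.1 - U'.1) (O * U.1ᴴ)
  have h4 := frob_mul_le (U'.1 * O) (U.1 - U'.1)ᴴ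
  rw [frob_conjTranspose] at h4
  have h5 := frob_nonneg (U.1 - U'.1)
  rw [h]
  refine (frob_add_le _ _).trans ?_
  nlinarith [mul_le_mul_of_nonneg_left h1 h5, mul_le_mul_of_nonneg_right h2 h5]

lemma opNorm_conjBy_le (O : Matrix n n ℂ) (U : Matrix.unitaryGroup n ℂ) :
    ‖conjBy O U‖ ≤ ‖O‖ := by
  refine (Matrix.l2_opNorm_mul _ _).trans ?_
  refine (mul_le_of_le_one_right (norm_nonneg _) (opNorm_unitary_conjTranspose_le U)).trans ?_
  exact (Matrix.l2_opNorm_mul _ _).trans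
    (mul_le_of_le_one_left (norm_nonneg _) (opNorm_unitary_le U))

lemma frob_conjBy (O : Matrix n n ℂ) (U : Matrix.unitaryGroup n ℂ) :
    frob (conjBy O U) = frob O := by
  refine le_antisymm ?_ ?_
  · refine (frob_mul_le' _ _).trans ?_
    refine (mul_le_of_le_one_right (frob_nonneg _) (opNorm_unitary_conjTranspose_le U)).trans ?_
    exact (frob_mul_le _ _).trans (mul_le_of_le_one_left (frob_nonneg _) (opNorm_unitary_le U))
  · have hU := unitary_conjTranspose_mul_self U
    have h : O = U.1ᴴ * (conjBy O U) * U.1 := by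
      have : U.1ᴴ * (conjBy O U) * U.1 = (U.1ᴴ * U.1) * O * (U.1ᴴ * U.1) := by
        simp only [conjBy, mul_assoc]
      rw [this, hU, one_mul, mul_one]
    conv_lhs => rw [h]
    refine (frob_mul_le' _ _).trans ?_
    refine (mul_le_of_le_one_right (frob_nonneg _) (opNorm_unitary_le U)).trans ?_
    exact (frob_mul_le _ _).trans
      (mul_le_of_le_one_left (frob_nonneg _) (opNorm_unitary_conjTranspose_le U))

lemma opNorm_phaseDiag_le (d : ℕ) {ε : ℝ} (hε : 0 ≤ ε) (θ : ℝ) : ‖phaseDiag d ε θ‖ ≤ ε := by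
  refine opNorm_diagonal_le hε fun k => ?_
  have h1 : ‖Complex.exp (Complex.I * θ)‖ = 1 := by rw [mul_comm, Complex.norm_exp_ofReal_mul_I]
  have h2 : ‖Complex.exp (-(Complex.I * θ))‖ = 1 := by
    rw [Complex.exp_neg, norm_inv, h1, inv_one]
  split_ifs
  · simpa using hε
  · rw [norm_mul, h1, Complex.norm_real, Real.norm_eq_abs, abs_of_nonneg hε, mul_one]
  · rw [norm_mul, h2, Complex.norm_real, Real.norm_eq_abs, abs_of_nonneg hε, mul_one]

lemma conjIsometry_eq (r dB : ℕ) (ε θ : ℝ) (U : Matrix.unitaryGroup (Fin (r * dB)) ℂ) :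
    conjIsometry r dB ε θ U =
      (1 + conjBy (phaseDiag (r * dB) ε θ) U).submatrix finProdFinEquiv id := by
  rw [conjIsometry, conjBy, mul_add, mul_one, add_mul, unitary_mul_conjTranspose_self]

lemma frob_conjIsometry_sub_le (r dB : ℕ) {ε : ℝ} (hε : 0 ≤ ε) (θ : ℝ)
    (U U' : Matrix.unitaryGroup (Fin (r * dB)) ℂ) :
    frob (conjIsometry r dB ε θ U - conjIsometry r dB ε θ U') ≤ 2 * ε * frob (U.1 - U'.1) := by
  have h : conjIsometry r dB ε θ U - conjIsometry r dB ε θ U'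
      = (conjBy (phaseDiag (r * dB) ε θ) U - conjBy (phaseDiag (r * dB) ε θ) U').submatrix
          finProdFinEquiv (Equiv.refl _) := by
    rw [conjIsometry_eq, conjIsometry_eq]
    ext i j
    simp
  rw [h, frob_reindex]
  refine (frob_conjBy_sub_le _ _ _).trans ?_
  have := opNorm_phaseDiag_le (r * dB) hε θ
  have := frob_nonneg (U.1 - U'.1)
  gcongr

lemma normSq_one_add_phase (θ : ℝ) :
    Complex.normSq (1 + ((-2 * Real.cos θ : ℝ) : ℂ) * Complex.exp (Complex.I * θ)) = 1 := by
  rw [mul_comm Complex.I, Complex.exp_mul_I, ← Complex.ofReal_cos, ← Complex.ofReal_sin,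
    Complex.normSq_apply]
  simp only [Complex.add_re, Complex.add_im, Complex.mul_re, Complex.mul_im, Complex.ofReal_re,
    Complex.ofReal_im, Complex.one_re, Complex.one_im, Complex.I_re, Complex.I_im]
  nlinarith [Real.sin_sq_add_cos_sq θ]

/-- `1 + O` is unitary because `ε = -2 cos θ`. -/
lemma one_add_phaseDiag_isometry (d : ℕ) (θ : ℝ) :
    (1 + phaseDiag d (-2 * Real.cos θ) θ)ᴴ * (1 + phaseDiag d (-2 * Real.cos θ) θ) = 1 := by
  rw [phaseDiag, ← Matrix.diagonal_one, Matrix.diagonal_add, Matrix.diagonal_conjTranspose,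
    Matrix.diagonal_mul_diagonal]
  congr 1
  funext k
  simp only [Pi.star_apply, RCLike.star_def]
  rw [mul_comm, Complex.mul_conj, ← Complex.ofReal_one]
  congr 1
  split_ifs
  · simp
  · exact normSq_one_add_phase θ
  · have := normSq_one_add_phase (-θ)
    rw [Real.cos_neg] at this
    refine Eq.trans ?_ this
    rw [Complex.ofReal_neg, mul_neg, Complex.ofReal_one]

lemma conjIsometry_isometry (r dB : ℕ) (θ : ℝ) (U : Matrix.unitaryGroup (Fin (r * dB)) ℂ) :
    (conjIsometry r dB (-2 * Real.cos θ) θ U)ᴴ * conjIsometry r dB (-2 * Real.cos θ) θ U = 1 := by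
  rw [conjIsometry, Matrix.conjTranspose_submatrix, Matrix.submatrix_mul_equiv,
    Matrix.submatrix_id_id]
  simp only [Matrix.conjTranspose_mul, Matrix.conjTranspose_conjTranspose]
  have : ∀ a b c e : Matrix (Fin (r * dB)) (Fin (r * dB)) ℂ,
      a * (b * e) * (a * c * e) = a * (b * (e * a) * c) * e := by
    intros; simp only [mul_assoc]
  rw [this, unitary_conjTranspose_mul_self, mul_one, one_add_phaseDiag_isometry, mul_one,
    unitary_mul_conjTranspose_self]

end Conj

/-! ### The flagged isometry -/

section Flag

open scoped Matrix.Norms.L2Operator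

lemma embedFirst_isometry {N dA : ℕ} (h : dA ≤ N) :
    (embedFirst N dA)ᴴ * embedFirst N dA = 1 := by
  ext x x'
  rw [Matrix.mul_apply, Finset.sum_eq_single (Fin.castLE h x)]
  · simp [embedFirst, Matrix.one_apply, Fin.ext_iff]
  · intro y _ hy
    have : (y : ℕ) ≠ x := fun h' => hy (Fin.ext h')
    simp [embedFirst, this]
  · simp

lemma haarIsometry_isometry {dA dB r : ℕ} (h : dA ≤ r * dB)
    (U : Matrix.unitaryGroup (Fin (r * dB)) ℂ) :
    (haarIsometry dA dB r U)ᴴ * haarIsometry dA dB r U = 1 := by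
  rw [haarIsometry, Matrix.conjTranspose_submatrix, Matrix.submatrix_mul_equiv,
    Matrix.submatrix_id_id, Matrix.conjTranspose_mul, Matrix.mul_assoc,
    ← Matrix.mul_assoc (U : Matrix (Fin (r * dB)) (Fin (r * dB)) ℂ)ᴴ,
    unitary_conjTranspose_mul_self, Matrix.one_mul, embedFirst_isometry h]

lemma krausIsometry_isometry {dA dB r : ℕ} {K : Fin r → Matrix (Fin dB) (Fin dA) ℂ}
    (hK : IsBalancedKraus K) : (krausIsometry K)ᴴ * krausIsometry K = 1 := by
  rw [← hK.complete]
  ext x x'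
  simp [Matrix.mul_apply, Matrix.sum_apply, krausIsometry, Fintype.sum_prod_type]

lemma flagIsometry_isometry {dA dB r : ℕ} (h : dA ≤ r * dB)
    {K : Fin r → Matrix (Fin dB) (Fin dA) ℂ} (hK : IsBalancedKraus K) {ε : ℝ} (hε0 : 0 ≤ ε)
    (hε : ε ≤ 1) (U : Matrix.unitaryGroup (Fin (r * dB)) ℂ) :
    (flagIsometry K ε U)ᴴ * flagIsometry K ε U = 1 := by
  have h1 : (flagIsometry K ε U)ᴴ * flagIsometry K ε U
      = ((1 - ε ^ 2 : ℝ) : ℂ) • ((krausIsometry K)ᴴ * krausIsometry K)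
        + ((ε ^ 2 : ℝ) : ℂ) • ((haarIsometry dA dB r U)ᴴ * haarIsometry dA dB r U) := by
    ext x x'
    have hs : ((Real.sqrt (1 - ε ^ 2) : ℝ) : ℂ) * ((Real.sqrt (1 - ε ^ 2) : ℝ) : ℂ)
        = ((1 - ε ^ 2 : ℝ) : ℂ) := by
      rw [← Complex.ofReal_mul, Real.mul_self_sqrt (by nlinarith)]
    simp only [Matrix.add_apply, Matrix.smul_apply, Matrix.mul_apply, Fintype.sum_prod_type,
      Fin.sum_univ_two, flagIsometry, Matrix.conjTranspose_apply, Matrix.of_apply,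
      Finset.sum_add_distrib, smul_eq_mul, Finset.mul_sum, ← hs]
    congr 1 <;> refine Finset.sum_congr rfl fun i _ => Finset.sum_congr rfl fun y _ => ?_
    · simp
      ring
    · simp
      ring
  rw [h1, krausIsometry_isometry hK, haarIsometry_isometry h, ← add_smul, ← Complex.ofReal_add]
  simp

lemma frob_flagIsometry_sub_le {dA dB r : ℕ} (h : dA ≤ r * dB)
    (K : Fin r → Matrix (Fin dB) (Fin dA) ℂ) {ε : ℝ} (hε : 0 ≤ ε)
    (U U' : Matrix.unitaryGroup (Fin (r * dB)) ℂ) :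
    frob (flagIsometry K ε U - flagIsometry K ε U') ≤ 2 * ε * frob (U.1 - U'.1) := by
  have h1 : frob (flagIsometry K ε U - flagIsometry K ε U')
      = ε * frob (haarIsometry dA dB r U - haarIsometry dA dB r U') := by
    refine (sq_eq_sq₀ (frob_nonneg _) (mul_nonneg hε (frob_nonneg _))).1 ?_
    rw [mul_pow, frob_sq, frob_sq, Fintype.sum_prod_type, Fintype.sum_prod_type, Finset.mul_sum]
    refine Finset.sum_congr rfl fun i _ => ?_
    rw [Fintype.sum_prod_type, Fin.sum_univ_two]
    simp [flagIsometry, ← mul_sub, mul_pow, Finset.mul_sum]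
  have h2 : haarIsometry dA dB r U - haarIsometry dA dB r U'
      = ((U.1 - U'.1) * embedFirst (r * dB) dA).submatrix finProdFinEquiv (Equiv.refl _) := by
    rw [haarIsometry, haarIsometry, Matrix.sub_mul]
    rfl
  have h3 := frob_mul_le' (U.1 - U'.1) (embedFirst (r * dB) dA)
  have h4 := opNorm_le_one_of_conjTranspose_mul (embedFirst_isometry h)
  have h5 := frob_nonneg (U.1 - U'.1)
  rw [h1, h2, frob_reindex]
  nlinarith [mul_le_mul_of_nonneg_left h4 h5, mul_nonneg hε h5]

end Flag

/-! ### Second moments of a Haar-random conjugate -/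

section Haar

variable {N : ℕ}

instance isProbabilityMeasure_haarU (n : ℕ) : IsProbabilityMeasure (haarU n) :=
  ⟨Measure.haarMeasure_self (K₀ := (⊤ : TopologicalSpace.PositiveCompacts
    (Matrix.unitaryGroup (Fin n) ℂ)))⟩

instance isMulLeftInvariant_haarU (n : ℕ) : (haarU n).IsMulLeftInvariant :=
  inferInstanceAs (Measure.haarMeasure ⊤).IsMulLeftInvariant

lemma continuous_unitary_coe :
    Continuous fun U : Matrix.unitaryGroup (Fin N) ℂ => (U : Matrix (Fin N) (Fin N) ℂ) :=
  continuous_subtype_val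

lemma integrable_haarU {E : Type*} [NormedAddCommGroup E]
    {f : Matrix.unitaryGroup (Fin N) ℂ → E} (hf : Continuous f) : Integrable f (haarU N) :=
  hf.integrable_of_hasCompactSupport (HasCompactSupport.of_compactSpace f)

lemma continuous_conjBy (O : Matrix (Fin N) (Fin N) ℂ) : Continuous (conjBy O) :=
  (continuous_unitary_coe.matrix_mul continuous_const).matrix_mul
    continuous_unitary_coe.matrix_conjTranspose

@[fun_prop]
lemma continuous_conjBy_apply (O : Matrix (Fin N) (Fin N) ℂ) (x y : Fin N) :
    Continuous fun U => conjBy O U x y :=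
  (continuous_conjBy O).matrix_elem x y

lemma integral_conjBy_invariant {E : Type*} [NormedAddCommGroup E] [NormedSpace ℝ E]
    (O : Matrix (Fin N) (Fin N) ℂ) (g : Matrix (Fin N) (Fin N) ℂ → E)
    (V : Matrix.unitaryGroup (Fin N) ℂ) :
    ∫ U, g (V.1 * conjBy O U * V.1ᴴ) ∂haarU N = ∫ U, g (conjBy O U) ∂haarU N := by
  rw [← integral_mul_left_eq_self (fun U => g (conjBy O U)) V]
  congr 1
  funext U
  congr 1
  simp only [conjBy, Submonoid.coe_mul, Matrix.conjTranspose_mul, mul_assoc]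

/-- The diagonal unitary with prescribed phases. -/
noncomputable def phaseUnitary (d : Fin N → ℂ) (hd : ∀ k, ‖d k‖ = 1) :
    Matrix.unitaryGroup (Fin N) ℂ :=
  ⟨Matrix.diagonal d, by
    rw [Matrix.mem_unitaryGroup_iff', Matrix.star_eq_conjTranspose, Matrix.diagonal_conjTranspose,
      Matrix.diagonal_mul_diagonal, ← Matrix.diagonal_one]
    congr 1
    funext k
    rw [Pi.star_apply, RCLike.star_def, Complex.conj_mul', hd k]
    simp⟩

/-- The unitary of a permutation of the basis. -/
noncomputable def permUnitary (σ : Equiv.Perm (Fin N)) : Matrix.unitaryGroup (Fin N) ℂ :=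
  ⟨(1 : Matrix (Fin N) (Fin N) ℂ).submatrix σ id, by
    rw [Matrix.mem_unitaryGroup_iff, Matrix.star_eq_conjTranspose, Matrix.conjTranspose_submatrix,
      Matrix.conjTranspose_one]
    have := Matrix.submatrix_mul_equiv (1 : Matrix (Fin N) (Fin N) ℂ) 1 σ (Equiv.refl _) σ
    rw [Matrix.mul_one, Matrix.submatrix_one_equiv] at this
    exact this⟩

lemma permUnitary_conj (σ : Equiv.Perm (Fin N)) (Q : Matrix (Fin N) (Fin N) ℂ) (x y : Fin N) :
    ((permUnitary σ).1 * Q * (permUnitary σ).1ᴴ) x y = Q (σ x) (σ y) := by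
  simp [permUnitary, Matrix.mul_apply, Matrix.one_apply]

lemma phaseUnitary_conj (d : Fin N → ℂ) (hd : ∀ k, ‖d k‖ = 1) (Q : Matrix (Fin N) (Fin N) ℂ)
    (x y : Fin N) :
    ((phaseUnitary d hd).1 * Q * (phaseUnitary d hd).1ᴴ) x y = d x * Q x y * star (d y) := by
  simp [phaseUnitary, Matrix.diagonal_conjTranspose]

lemma permUnitary_swap_conjTranspose (x y : Fin N) :
    (permUnitary (Equiv.swap x y)).1ᴴ = (permUnitary (Equiv.swap x y)).1 := by
  ext u v
  simp only [permUnitary, Matrix.conjTranspose_apply, Matrix.submatrix_apply, Matrix.one_apply,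
    id, apply_ite star, star_one, star_zero]
  have : (Equiv.swap x y) v = u ↔ (Equiv.swap x y) u = v := by
    rw [Equiv.swap_apply_eq_iff, eq_comm]
  simp only [this]

/-- The unitary `(1 + iP)/√2`, where `P` transposes two basis vectors. -/
noncomputable def mixUnitary (x y : Fin N) : Matrix.unitaryGroup (Fin N) ℂ :=
  ⟨((1 / Real.sqrt 2 : ℝ) : ℂ) • (1 + Complex.I • (permUnitary (Equiv.swap x y)).1), by
    rw [Matrix.mem_unitaryGroup_iff, Matrix.star_eq_conjTranspose, Matrix.conjTranspose_smul,
      Matrix.conjTranspose_add, Matrix.conjTranspose_smul, Matrix.conjTranspose_one]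
    have h := unitary_mul_conjTranspose_self (permUnitary (Equiv.swap x y))
    rw [permUnitary_swap_conjTranspose] at h ⊢
    have h2 : ((1 / Real.sqrt 2 : ℝ) : ℂ) * star ((1 / Real.sqrt 2 : ℝ) : ℂ) = 1 / 2 := by
      rw [RCLike.star_def, Complex.conj_ofReal, ← Complex.ofReal_mul, div_mul_div_comm, one_mul,
        Real.mul_self_sqrt (by norm_num)]
      norm_num
    rw [smul_mul_smul_comm, h2]
    simp only [mul_add, add_mul, mul_one, one_mul, smul_mul_smul_comm, h]
    simp only [RCLike.star_def, Complex.conj_I, mul_neg, Complex.I_mul_I, neg_neg, one_smul,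
      neg_smul]
    rw [show ((1 : Matrix (Fin N) (Fin N) ℂ) + Complex.I • (permUnitary (Equiv.swap x y)).1 +
      (-(Complex.I • (permUnitary (Equiv.swap x y)).1) + 1)) = (2 : ℂ) • 1 by
        rw [two_smul]; abel, smul_smul]
    norm_num⟩

lemma mixUnitary_conj (x y : Fin N) (Q : Matrix (Fin N) (Fin N) ℂ) :
    ((mixUnitary x y).1 * Q * (mixUnitary x y).1ᴴ) x x
      = 1 / 2 * (Q x x + Q y y + Complex.I * Q y x - Complex.I * Q x y) := by
  have h2 : ((1 / Real.sqrt 2 : ℝ) : ℂ) * star ((1 / Real.sqrt 2 : ℝ) : ℂ) = 1 / 2 := by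
    rw [RCLike.star_def, Complex.conj_ofReal, ← Complex.ofReal_mul, div_mul_div_comm, one_mul,
      Real.mul_self_sqrt (by norm_num)]
    norm_num
  have hP := permUnitary_conj (Equiv.swap x y) Q x x
  rw [Equiv.swap_apply_left] at hP
  set P := (permUnitary (Equiv.swap x y)).1 with hPdef
  have e1 : (P * Q) x x = Q y x := by
    simp [hPdef, permUnitary, Matrix.mul_apply, Matrix.one_apply]
  have e2 : (Q * Pᴴ) x x = Q x y := by
    simp [hPdef, permUnitary, Matrix.mul_apply, Matrix.one_apply]
  have e3 : (mixUnitary x y).1 * Q * (mixUnitary x y).1ᴴ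
      = (1 / 2 : ℂ) • (Q + P * Q * Pᴴ + Complex.I • (P * Q) - Complex.I • (Q * Pᴴ)) := by
    rw [mixUnitary, Matrix.conjTranspose_smul, Matrix.smul_mul, smul_mul_smul_comm, h2,
      Matrix.conjTranspose_add, Matrix.conjTranspose_smul, Matrix.conjTranspose_one, ← hPdef]
    congr 1
    simp only [mul_add, add_mul, mul_one, one_mul, Matrix.smul_mul, Matrix.mul_smul, smul_smul,
      RCLike.star_def, Complex.conj_I, mul_neg, Complex.I_mul_I, one_smul, neg_smul]
    abel
  rw [e3]
  simp [e1, e2, hP]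

/-- The second moment `𝔼 [Q_{xy} conj Q_{zw}]` of `Q = U O U†` for Haar-random `U`. -/
noncomputable def conjMoment (O : Matrix (Fin N) (Fin N) ℂ) (x y z w : Fin N) : ℂ :=
  ∫ U, conjBy O U x y * star (conjBy O U z w) ∂haarU N

variable (O : Matrix (Fin N) (Fin N) ℂ)

lemma conjMoment_perm (σ : Equiv.Perm (Fin N)) (x y z w : Fin N) :
    conjMoment O (σ x) (σ y) (σ z) (σ w) = conjMoment O x y z w := by
  have h := integral_conjBy_invariant O (fun Q => Q x y * star (Q z w)) (permUnitary σ)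
  simp only [permUnitary_conj] at h
  exact h

lemma conjMoment_phase (d : Fin N → ℂ) (hd : ∀ k, ‖d k‖ = 1) (x y z w : Fin N) :
    d x * star (d y) * (star (d z) * d w) * conjMoment O x y z w = conjMoment O x y z w := by
  have h := integral_conjBy_invariant O (fun Q => Q x y * star (Q z w)) (phaseUnitary d hd)
  simp only [phaseUnitary_conj] at h
  rw [conjMoment]
  refine Eq.trans ?_ h
  rw [← integral_const_mul]
  congr 1
  funext U
  simp only [star_mul', star_star]
  ring

/-- A moment vanishes when flipping the sign of the basis vector `k` flips its sign. -/
lemma conjMoment_eq_zero_of_sign (k x y z w : Fin N)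
    (h : (if x = k then (-1 : ℂ) else 1) * (if y = k then -1 else 1) *
      ((if z = k then -1 else 1) * (if w = k then -1 else 1)) = -1) :
    conjMoment O x y z w = 0 := by
  have h1 := conjMoment_phase O (fun j => if j = k then (-1 : ℂ) else 1)
    (fun j => by split_ifs <;> simp) x y z w
  simp only [apply_ite star, star_neg, star_one] at h1
  rw [h] at h1
  linear_combination (-1 / 2) * h1

lemma conjMoment_swap_eq_zero {x y : Fin N} (h : x ≠ y) : conjMoment O x y y x = 0 := by
  have h1 := conjMoment_phase O (fun j => if j = x then Complex.I else 1)
    (fun j => by split_ifs <;> simp) x y y x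
  simp only [if_true, if_neg h.symm, star_one, mul_one, one_mul, Complex.I_mul_I] at h1
  linear_combination (-1 / 2) * h1

lemma exists_perm_pair {x y x' y' : Fin N} (h : x ≠ y) (h' : x' ≠ y') :
    ∃ σ : Equiv.Perm (Fin N), σ x = x' ∧ σ y = y' := by
  refine ⟨Equiv.swap (Equiv.swap x x' y) y' * Equiv.swap x x', ?_, ?_⟩
  · rw [Equiv.Perm.mul_apply, Equiv.swap_apply_left]
    refine Equiv.swap_apply_of_ne_of_ne (fun h1 => h ?_) h'
    have := congrArg (Equiv.swap x x') h1
    rwa [Equiv.swap_apply_self, Equiv.swap_apply_right] at this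
  · rw [Equiv.Perm.mul_apply, Equiv.swap_apply_left]

lemma sum_mul_conjMoment {ι : Type*} [Fintype ι] (c : ι → ℂ) (x y z w : ι → Fin N) :
    ∑ i, c i * conjMoment O (x i) (y i) (z i) (w i)
      = ∫ U, ∑ i, c i * (conjBy O U (x i) (y i) * star (conjBy O U (z i) (w i))) ∂haarU N := by
  rw [integral_finsetSum _ fun i _ => integrable_haarU (by fun_prop)]
  simp only [integral_const_mul, conjMoment]

lemma sum_conjMoment {ι : Type*} [Fintype ι] (x y z w : ι → Fin N) :
    ∑ i, conjMoment O (x i) (y i) (z i) (w i)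
      = ∫ U, ∑ i, conjBy O U (x i) (y i) * star (conjBy O U (z i) (w i)) ∂haarU N := by
  simpa only [one_mul] using sum_mul_conjMoment O (fun _ => 1) x y z w

/-- The rotation `(1 + iP)/√2` links the three kinds of second moments. -/
lemma conjMoment_diag {x y : Fin N} (h : x ≠ y) :
    conjMoment O x x x x = conjMoment O x x y y + conjMoment O x y x y := by
  have h1 := integral_conjBy_invariant O (fun Q => Q x x * star (Q x x)) (mixUnitary x y)
  simp only [mixUnitary_conj] at h1
  have h2 : ∀ U, 1 / 2 * (conjBy O U x x + conjBy O U y y + Complex.I * conjBy O U y x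
        - Complex.I * conjBy O U x y) * star (1 / 2 * (conjBy O U x x + conjBy O U y y
        + Complex.I * conjBy O U y x - Complex.I * conjBy O U x y))
      = ∑ u : Fin 4, ∑ v : Fin 4, (![1, 1, Complex.I, -Complex.I] u *
        star (![1, 1, Complex.I, -Complex.I] v) / 4) *
          (conjBy O U (![x, y, y, x] u) (![x, y, x, y] u) *
            star (conjBy O U (![x, y, y, x] v) (![x, y, x, y] v))) := by
    intro U
    simp only [Fin.sum_univ_four, star_mul', star_add, star_sub, RCLike.star_def, Complex.conj_I,
      map_div₀, map_one, map_ofNat]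
    simp
    ring_nf
    simp only [Complex.I_sq]
    ring
  simp only [h2] at h1
  have h3 := sum_mul_conjMoment O (ι := Fin 4 × Fin 4)
    (fun p => ![1, 1, Complex.I, -Complex.I] p.1 * star (![1, 1, Complex.I, -Complex.I] p.2) / 4)
    (fun p => ![x, y, y, x] p.1) (fun p => ![x, y, x, y] p.1)
    (fun p => ![x, y, y, x] p.2) (fun p => ![x, y, x, y] p.2)
  simp only [Fintype.sum_prod_type] at h3
  rw [← h3] at h1
  change _ = conjMoment O x x x x at h1
  have z1 : conjMoment O x x y x = 0 := conjMoment_eq_zero_of_sign O y _ _ _ _ (by simp [h])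
  have z2 : conjMoment O x x x y = 0 := conjMoment_eq_zero_of_sign O y _ _ _ _ (by simp [h])
  have z3 : conjMoment O y y y x = 0 := conjMoment_eq_zero_of_sign O x _ _ _ _ (by simp [h.symm])
  have z4 : conjMoment O y y x y = 0 := conjMoment_eq_zero_of_sign O x _ _ _ _ (by simp [h.symm])
  have z5 : conjMoment O y x x x = 0 := conjMoment_eq_zero_of_sign O y _ _ _ _ (by simp [h])
  have z6 : conjMoment O x y x x = 0 := conjMoment_eq_zero_of_sign O y _ _ _ _ (by simp [h])
  have z7 : conjMoment O y x y y = 0 := conjMoment_eq_zero_of_sign O x _ _ _ _ (by simp [h.symm])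
  have z8 : conjMoment O x y y y = 0 := conjMoment_eq_zero_of_sign O x _ _ _ _ (by simp [h.symm])
  have z9 := conjMoment_swap_eq_zero O h
  have z10 := conjMoment_swap_eq_zero O h.symm
  have p1 := conjMoment_perm O (Equiv.swap x y) x x x x
  have p2 := conjMoment_perm O (Equiv.swap x y) x x y y
  have p3 := conjMoment_perm O (Equiv.swap x y) x y x y
  simp only [Equiv.swap_apply_left, Equiv.swap_apply_right] at p1 p2 p3
  simp [Fin.sum_univ_four, z1, z2, z3, z4, z5, z6, z7, z8, z9, z10, p1, p2, p3] at h1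
  linear_combination (-2) * h1

/-- The second moments of `U O U†` with index patterns `(x, x, z, z)` and `(x, y, x, y)` depend on
two numbers only. -/
lemma exists_conjMoment_eq (hN : 2 ≤ N) : ∃ β γ : ℂ,
    (∀ x z, conjMoment O x x z z = β + if x = z then γ else 0) ∧
    (∀ x y, conjMoment O x y x y = γ + if x = y then β else 0) := by
  have : Nontrivial (Fin N) := Fin.nontrivial_iff_two_le.2 hN
  obtain ⟨u, v, huv⟩ := exists_pair_ne (Fin N)
  have hβ : ∀ x y, x ≠ y → conjMoment O x x y y = conjMoment O u u v v := by
    intro x y hxy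
    obtain ⟨σ, rfl, rfl⟩ := exists_perm_pair huv hxy
    exact conjMoment_perm O σ u u v v
  have hγ : ∀ x y, x ≠ y → conjMoment O x y x y = conjMoment O u v u v := by
    intro x y hxy
    obtain ⟨σ, rfl, rfl⟩ := exists_perm_pair huv hxy
    exact conjMoment_perm O σ u v u v
  have hα : ∀ x, conjMoment O x x x x = conjMoment O u u v v + conjMoment O u v u v := by
    intro x
    obtain ⟨y, hy⟩ := exists_ne x
    rw [conjMoment_diag O hy.symm, hβ x y hy.symm, hγ x y hy.symm]
  refine ⟨conjMoment O u u v v, conjMoment O u v u v, fun x z => ?_, fun x y => ?_⟩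
  · split_ifs with hxz
    · rw [← hxz, hα]
    · rw [hβ x z hxz, add_zero]
  · split_ifs with hxy
    · rw [← hxy, hα, add_comm]
    · rw [hγ x y hxy, add_zero]

lemma trace_conjBy {n : Type*} [Fintype n] [DecidableEq n] (O : Matrix n n ℂ)
    (U : Matrix.unitaryGroup n ℂ) : (conjBy O U).trace = O.trace := by
  rw [conjBy, Matrix.trace_mul_comm, ← mul_assoc, unitary_conjTranspose_mul_self, one_mul]

lemma sum_conjMoment_diag :
    ∑ x, ∑ z, conjMoment O x x z z = ((‖O.trace‖ ^ 2 : ℝ) : ℂ) := by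
  have h := sum_conjMoment O (ι := Fin N × Fin N) (fun p => p.1) (fun p => p.1)
    (fun p => p.2) (fun p => p.2)
  simp only [Fintype.sum_prod_type] at h
  rw [h]
  have : ∀ U, ∑ x, ∑ z, conjBy O U x x * star (conjBy O U z z) = ((‖O.trace‖ ^ 2 : ℝ) : ℂ) := by
    intro U
    rw [← Finset.sum_mul_sum, ← star_sum]
    change (conjBy O U).trace * star (conjBy O U).trace = _
    rw [trace_conjBy, RCLike.star_def, Complex.mul_conj']
    push_cast
    rfl
  simp only [this]
  simp

lemma sum_conjMoment_offdiag :
    ∑ x, ∑ y, conjMoment O x y x y = ((frob O ^ 2 : ℝ) : ℂ) := by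
  have h := sum_conjMoment O (ι := Fin N × Fin N) (fun p => p.1) (fun p => p.2)
    (fun p => p.1) (fun p => p.2)
  simp only [Fintype.sum_prod_type] at h
  rw [h]
  have : ∀ U, ∑ x, ∑ y, conjBy O U x y * star (conjBy O U x y) = ((frob O ^ 2 : ℝ) : ℂ) := by
    intro U
    rw [← frob_conjBy O U, frob_sq]
    push_cast
    simp only [RCLike.star_def, Complex.mul_conj']
  simp only [this]
  simp

/-- The partial trace over `B` of an operator on `E ⊗ B`, identified with `ℂ^{r d_B}`. -/
noncomputable def traceOutB {r dB : ℕ} (Q : Matrix (Fin (r * dB)) (Fin (r * dB)) ℂ) :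
    Matrix (Fin r) (Fin r) ℂ :=
  Matrix.of fun i j => ∑ y, Q (finProdFinEquiv (i, y)) (finProdFinEquiv (j, y))

lemma continuous_frob_sq_traceOutB {r dB : ℕ} (O : Matrix (Fin (r * dB)) (Fin (r * dB)) ℂ) :
    Continuous fun U => frob (traceOutB (conjBy O U)) ^ 2 := by
  simp only [frob_sq, traceOutB, Matrix.of_apply]
  fun_prop

/-- The mean purity of a reduced operator: with `N = r d_B`,
`(N² - 1) 𝔼 ‖Tr_B (U O U†)‖₂² = r (N ‖O‖₂² - |Tr O|²) + d_B (N |Tr O|² - ‖O‖₂²)`. -/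
lemma integral_frob_traceOutB {r dB : ℕ} (hN : 2 ≤ r * dB)
    (O : Matrix (Fin (r * dB)) (Fin (r * dB)) ℂ) :
    (((r * dB : ℕ) : ℝ) ^ 2 - 1) *
        ∫ U, frob (traceOutB (conjBy O U)) ^ 2 ∂haarU (r * dB)
      = r * ((r * dB : ℕ) * frob O ^ 2 - ‖O.trace‖ ^ 2)
        + dB * ((r * dB : ℕ) * ‖O.trace‖ ^ 2 - frob O ^ 2) := by
  obtain ⟨β, γ, h1, h2⟩ := exists_conjMoment_eq O hN
  have t1 := sum_conjMoment_diag O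
  have t2 := sum_conjMoment_offdiag O
  simp only [h1, h2, Finset.sum_add_distrib, Finset.sum_ite_eq, Finset.mem_univ, if_true,
    Finset.sum_const, Finset.card_univ, Fintype.card_fin, nsmul_eq_mul] at t1 t2
  have h3 : ∀ (i j : Fin r) (y y' : Fin dB),
      conjMoment O (finProdFinEquiv (i, y)) (finProdFinEquiv (j, y)) (finProdFinEquiv (i, y'))
        (finProdFinEquiv (j, y')) = (if i = j then β else 0) + if y = y' then γ else 0 := by
    intro i j y y'
    by_cases hij : i = j
    · subst hij
      rw [h1]
      simp
    · by_cases hy : y = y'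
      · subst hy
        rw [h2]
        simp [hij]
      · rw [conjMoment_eq_zero_of_sign O (finProdFinEquiv (i, y))]
        · simp [hij, hy]
        · simp [Ne.symm hij, Ne.symm hy]
  have h4 : ((∫ U, frob (traceOutB (conjBy O U)) ^ 2 ∂haarU (r * dB) : ℝ) : ℂ)
      = ∑ i : Fin r, ∑ j : Fin r, ∑ y : Fin dB, ∑ y' : Fin dB,
        conjMoment O (finProdFinEquiv (i, y)) (finProdFinEquiv (j, y)) (finProdFinEquiv (i, y'))
        (finProdFinEquiv (j, y')) := by
    have h := sum_conjMoment O (ι := Fin r × Fin r × Fin dB × Fin dB)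
      (fun p => finProdFinEquiv (p.1, p.2.2.1)) (fun p => finProdFinEquiv (p.2.1, p.2.2.1))
      (fun p => finProdFinEquiv (p.1, p.2.2.2)) (fun p => finProdFinEquiv (p.2.1, p.2.2.2))
    simp only [Fintype.sum_prod_type] at h
    rw [h, ← integral_complex_ofReal]
    congr 1
    funext U
    rw [frob_sq]
    push_cast
    refine Finset.sum_congr rfl fun i _ => Finset.sum_congr rfl fun j _ => ?_
    rw [← Complex.mul_conj', ← Finset.sum_mul_sum, traceOutB, Matrix.of_apply, map_sum]
    rfl
  simp only [h3, Finset.sum_add_distrib, Finset.sum_ite_eq, Finset.mem_univ, if_true,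
    Finset.sum_const, Finset.card_univ, Fintype.card_fin, nsmul_eq_mul] at h4
  have h5 : (((r * dB : ℕ) : ℂ) ^ 2 - 1) *
        ((∫ U, frob (traceOutB (conjBy O U)) ^ 2 ∂haarU (r * dB) : ℝ) : ℂ)
      = r * ((r * dB : ℕ) * ((frob O ^ 2 : ℝ) : ℂ) - ((‖O.trace‖ ^ 2 : ℝ) : ℂ))
        + dB * ((r * dB : ℕ) * ((‖O.trace‖ ^ 2 : ℝ) : ℂ) - ((frob O ^ 2 : ℝ) : ℂ)) := by
    rw [h4, ← t1, ← t2]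
    push_cast
    simp only [Finset.sum_const, Finset.card_univ, Fintype.card_fin, nsmul_eq_mul,
      mul_ite, mul_zero, Finset.sum_ite_eq, Finset.mem_univ, if_true]
    ring
  exact_mod_cast h5

lemma integral_conjBy_apply (x y : Fin N) :
    ∫ U, conjBy O U x y ∂haarU N = if x = y then O.trace / N else 0 := by
  split_ifs with hxy
  · subst hxy
    have hN : (N : ℂ) ≠ 0 := by
      have := x.pos
      exact_mod_cast this.ne'
    have h1 : ∀ z, ∫ U, conjBy O U z z ∂haarU N = ∫ U, conjBy O U x x ∂haarU N := by
      intro z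
      have h := integral_conjBy_invariant O (fun Q => Q x x) (permUnitary (Equiv.swap x z))
      simpa only [permUnitary_conj, Equiv.swap_apply_left] using h
    have h2 : ∑ z, ∫ U, conjBy O U z z ∂haarU N = O.trace := by
      rw [← integral_finsetSum _ fun i _ => integrable_haarU (by fun_prop)]
      have : ∀ U, ∑ z, conjBy O U z z = O.trace := fun U => trace_conjBy O U
      simp [this]
    rw [Finset.sum_congr rfl fun z _ => h1 z, Finset.sum_const, Finset.card_univ,
      Fintype.card_fin, nsmul_eq_mul] at h2
    rw [← h2, mul_div_cancel_left₀ _ hN]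
  · have h := integral_conjBy_invariant O (fun Q => Q x y)
      (phaseUnitary (fun j => if j = x then (-1 : ℂ) else 1) fun j => by split_ifs <;> simp)
    simp only [phaseUnitary_conj, if_true, if_neg (Ne.symm hxy), star_one, mul_one, neg_mul,
      one_mul, integral_neg] at h
    linear_combination (-1 / 2) * h

lemma integral_unitary_apply (x y : Fin N) : ∫ U, U.1 x y ∂haarU N = 0 := by
  have h := integral_mul_left_eq_self (μ := haarU N)
    (fun U : Matrix.unitaryGroup (Fin N) ℂ => U.1 x y)
    (phaseUnitary (fun _ => (-1 : ℂ)) fun _ => by simp)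
  have h2 : ∀ U : Matrix.unitaryGroup (Fin N) ℂ,
      ((phaseUnitary (fun _ => (-1 : ℂ)) fun _ => by simp) * U).1 x y = - U.1 x y := by
    intro U
    simp [phaseUnitary]
  simp only [h2, integral_neg] at h
  linear_combination (-1 / 2) * h

end Haar

/-! ### Averaging over pairs of unitaries -/

section Average

variable {N : ℕ}

instance secondCountable_unitaryGroup (n : ℕ) :
    SecondCountableTopology (Matrix.unitaryGroup (Fin n) ℂ) :=
  have : SecondCountableTopology (Matrix (Fin n) (Fin n) ℂ) :=
    inferInstanceAs (SecondCountableTopology (Fin n → Fin n → ℂ))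
  TopologicalSpace.Subtype.secondCountableTopology
    (Matrix.unitaryGroup (Fin n) ℂ : Set (Matrix (Fin n) (Fin n) ℂ))

lemma continuous_frob_sq {X m n : Type*} [TopologicalSpace X] [Fintype m] [Fintype n]
    {F : X → Matrix m n ℂ} (hF : Continuous F) : Continuous fun x => frob (F x) ^ 2 := by
  simp only [frob_sq]
  exact continuous_finsetSum _ fun i _ => continuous_finsetSum _ fun j _ =>
    ((hF.matrix_elem i j).norm).pow 2

lemma continuous_of_hsNorm_lipschitz
    {f : Matrix.unitaryGroup (Fin N) ℂ × Matrix.unitaryGroup (Fin N) ℂ → ℝ} (C : ℝ)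
    (h : ∀ U U', |f U - f U'| ≤ C * Real.sqrt (hsNorm (U.1.1 - U'.1.1) ^ 2
      + hsNorm (U.2.1 - U'.2.1) ^ 2)) : Continuous f := by
  rw [continuous_iff_continuousAt]
  intro U'
  have hc : Continuous fun U : Matrix.unitaryGroup (Fin N) ℂ × Matrix.unitaryGroup (Fin N) ℂ =>
      C * Real.sqrt (hsNorm (U.1.1 - U'.1.1) ^ 2 + hsNorm (U.2.1 - U'.2.1) ^ 2) := by
    simp only [hsNorm_eq_frob]
    exact continuous_const.mul (Real.continuous_sqrt.comp
      ((continuous_frob_sq ((continuous_unitary_coe.comp continuous_fst).sub continuous_const)).add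
        (continuous_frob_sq ((continuous_unitary_coe.comp continuous_snd).sub continuous_const))))
  have h0 := hc.tendsto U'
  have hz : C * Real.sqrt (hsNorm (U'.1.1 - U'.1.1) ^ 2 + hsNorm (U'.2.1 - U'.2.1) ^ 2) = 0 := by
    simp [hsNorm]
  rw [hz] at h0
  rw [ContinuousAt, tendsto_iff_dist_tendsto_zero]
  refine squeeze_zero (fun _ => dist_nonneg) (fun U => ?_) h0
  rw [Real.dist_eq]
  exact h U U'

lemma integrable_section_haarU
    {f : Matrix.unitaryGroup (Fin N) ℂ → Matrix.unitaryGroup (Fin N) ℂ → ℝ}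
    (hf : Continuous fun U : Matrix.unitaryGroup (Fin N) ℂ × Matrix.unitaryGroup (Fin N) ℂ =>
      f U.1 U.2) (U₁ : Matrix.unitaryGroup (Fin N) ℂ) : Integrable (f U₁) (haarU N) :=
  integrable_haarU (hf.comp (Continuous.prodMk_right U₁))

/-- To bound `𝔼 f(U₁, U₂)` from below it suffices to bound the average over `U₂` for each fixed
`U₁`. -/
lemma integral_le_integral_prod_haarU
    {f : Matrix.unitaryGroup (Fin N) ℂ → Matrix.unitaryGroup (Fin N) ℂ → ℝ}
    (hf : Continuous fun U : Matrix.unitaryGroup (Fin N) ℂ × Matrix.unitaryGroup (Fin N) ℂ =>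
      f U.1 U.2) {g : Matrix.unitaryGroup (Fin N) ℂ → ℝ} (hg : Continuous g)
    (h : ∀ U₁, g U₁ ≤ ∫ U₂, f U₁ U₂ ∂haarU N) :
    ∫ U, g U ∂haarU N ≤ ∫ U, f U.1 U.2 ∂((haarU N).prod (haarU N)) := by
  have hi : Integrable
      (fun U : Matrix.unitaryGroup (Fin N) ℂ × Matrix.unitaryGroup (Fin N) ℂ => f U.1 U.2)
      ((haarU N).prod (haarU N)) :=
    hf.integrable_of_hasCompactSupport (HasCompactSupport.of_compactSpace _)
  rw [integral_prod _ hi]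
  exact integral_mono (integrable_haarU hg) hi.integral_prod_left h

end Average

/-! ### Norms and Gram matrices of reshaped operators -/

section Reshape

open scoped Matrix.Norms.L2Operator

variable {a b e : Type*} [Fintype a] [DecidableEq a] [Fintype b] [DecidableEq b] [Fintype e]

/-- The Gram matrix of the columns of reshaped operators is a partial trace over `B`. -/
lemma conjTranspose_choiFactor_mul_apply (V V' : Matrix (e × b) a ℂ) (i j : e) :
    ((choiFactor V)ᴴ * choiFactor V') i j
      = (Fintype.card a : ℂ)⁻¹ * ∑ y, (V' * Vᴴ) (j, y) (i, y) := by
  have hs : ((1 / Real.sqrt (Fintype.card a) : ℝ) : ℂ) * ((1 / Real.sqrt (Fintype.card a) : ℝ) : ℂ)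
      = (Fintype.card a : ℂ)⁻¹ := by
    rw [← Complex.ofReal_mul, div_mul_div_comm, Real.mul_self_sqrt (by positivity)]
    simp
  simp only [Matrix.mul_apply, Fintype.sum_prod_type, Matrix.conjTranspose_apply,
    choiFactor_apply, Finset.mul_sum, ← hs]
  rw [Finset.sum_comm]
  refine Finset.sum_congr rfl fun y _ => Finset.sum_congr rfl fun x _ => ?_
  rw [star_mul', RCLike.star_def, Complex.conj_ofReal]
  ring

variable [DecidableEq e]

lemma opNorm_choiFactor_le (V : Matrix (e × b) a ℂ) :
    ‖choiFactor V‖ ≤ Real.sqrt (Fintype.card b / Fintype.card a) * ‖V‖ := by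
  refine opNorm_le_of_sum_sq_le _ (by positivity) fun x => ?_
  have h1 : ∀ y : b, ∑ t, ‖(Vᴴ *ᵥ fun p : e × b => if p.2 = y then star (x p.1) else 0) t‖ ^ 2
      ≤ ‖V‖ ^ 2 * ∑ i, ‖x i‖ ^ 2 := by
    intro y
    refine (sum_norm_mulVec_sq_le _ _).trans (le_of_eq ?_)
    rw [Matrix.l2_opNorm_conjTranspose, Fintype.sum_prod_type]
    congr 1
    refine Finset.sum_congr rfl fun i _ => ?_
    rw [Finset.sum_eq_single y] <;> simp +contextual
  have h2 : ∀ t y, ‖(choiFactor V *ᵥ x) (t, y)‖ ^ 2 = (Fintype.card a : ℝ)⁻¹ *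
      ‖(Vᴴ *ᵥ fun p : e × b => if p.2 = y then star (x p.1) else 0) t‖ ^ 2 := by
    intro t y
    have h3 : (choiFactor V *ᵥ x) (t, y) = ((1 / Real.sqrt (Fintype.card a) : ℝ) : ℂ) *
        star ((Vᴴ *ᵥ fun p : e × b => if p.2 = y then star (x p.1) else 0) t) := by
      simp only [Matrix.mulVec, dotProduct, Fintype.sum_prod_type, choiFactor_apply, star_sum,
        Matrix.conjTranspose_apply, Finset.mul_sum]
      refine Finset.sum_congr rfl fun i _ => ?_
      rw [Finset.sum_eq_single y]
      · simp only [if_true, star_mul', star_star]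
        ring
      · intro y' _ hy'
        simp [hy']
      · simp
    rw [h3, norm_mul, mul_pow, norm_star, Complex.norm_real, Real.norm_eq_abs, sq_abs, div_pow,
      Real.sq_sqrt (by positivity), one_pow, one_div]
  rw [Fintype.sum_prod_type_right]
  simp only [h2, ← Finset.mul_sum]
  rw [mul_pow, Real.sq_sqrt (by positivity)]
  calc _ ≤ (Fintype.card a : ℝ)⁻¹ * ∑ _y : b, ‖V‖ ^ 2 * ∑ i, ‖x i‖ ^ 2 := by
        gcongr with y
        exact h1 y
    _ = _ := by
        rw [Finset.sum_const, Finset.card_univ, nsmul_eq_mul]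
        ring

lemma opNorm_le_one_of_projection {P : Matrix a a ℂ} (h : Pᴴ * P = P) : ‖P‖ ≤ 1 := by
  have h1 := Matrix.l2_opNorm_conjTranspose_mul_self P
  rw [h] at h1
  by_contra hc
  push Not at hc
  nlinarith

lemma opNorm_submatrix_equiv_le (σ : e ≃ a) (Q : Matrix a b ℂ) :
    ‖Q.submatrix σ id‖ ≤ ‖Q‖ := by
  refine opNorm_le_of_sum_sq_le _ (norm_nonneg _) fun x => ?_
  refine le_trans (le_of_eq ?_) (sum_norm_mulVec_sq_le Q x)
  rw [← σ.sum_comp]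
  rfl

end Reshape

/-! ### Testing against a contraction for the conjugated diagonal unitary -/

section Conj

open scoped Matrix.Norms.L2Operator

variable {r dB : ℕ}

/-- The reshaped operator of a square matrix on `E ⊗ B`, identified with `ℂ^{r d_B}`. -/
noncomputable def reshape (r dB : ℕ) (Q : Matrix (Fin (r * dB)) (Fin (r * dB)) ℂ) :
    Matrix (Fin (r * dB) × Fin dB) (Fin r) ℂ :=
  choiFactor (Q.submatrix finProdFinEquiv id)

lemma reshape_add (Q Q' : Matrix (Fin (r * dB)) (Fin (r * dB)) ℂ) :
    reshape r dB (Q + Q') = reshape r dB Q + reshape r dB Q' := by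
  ext p i
  simp [reshape, choiFactor_apply, mul_add]

lemma frob_reshape_sq (Q : Matrix (Fin (r * dB)) (Fin (r * dB)) ℂ) :
    frob (reshape r dB Q) ^ 2 = frob Q ^ 2 / (r * dB : ℕ) := by
  have h : frob (Q.submatrix finProdFinEquiv id) = frob Q :=
    frob_reindex finProdFinEquiv (Equiv.refl _) Q
  rw [reshape, frob_choiFactor, h, mul_pow, div_pow, Real.sq_sqrt (by positivity), Fintype.card_fin]
  ring

lemma opNorm_reshape_le (hr : 1 ≤ r) (hdB : 1 ≤ dB)
    (Q : Matrix (Fin (r * dB)) (Fin (r * dB)) ℂ) :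
    ‖reshape r dB Q‖ ≤ ‖Q‖ / Real.sqrt r := by
  refine (opNorm_choiFactor_le _).trans ?_
  have h1 := opNorm_submatrix_equiv_le finProdFinEquiv Q
  have h2 : Real.sqrt ((Fintype.card (Fin dB) : ℝ) / (Fintype.card (Fin (r * dB)) : ℝ))
      = 1 / Real.sqrt r := by
    have hd : (dB : ℝ) ≠ 0 := by positivity
    rw [Fintype.card_fin, Fintype.card_fin, one_div, ← Real.sqrt_inv]
    congr 1
    push_cast
    field_simp
  rw [h2, div_mul_eq_mul_div, one_mul]
  exact div_le_div_of_nonneg_right h1 (Real.sqrt_nonneg _)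

lemma reshape_one_conjTranspose_mul (Q : Matrix (Fin (r * dB)) (Fin (r * dB)) ℂ) :
    (reshape r dB 1)ᴴ * reshape r dB Q = ((r * dB : ℕ) : ℂ)⁻¹ • (traceOutB Q)ᵀ := by
  ext i j
  rw [reshape, reshape, conjTranspose_choiFactor_mul_apply, Fintype.card_fin, Matrix.smul_apply,
    smul_eq_mul, Matrix.transpose_apply, traceOutB, Matrix.of_apply]
  congr 1
  refine Finset.sum_congr rfl fun y _ => ?_
  rw [Matrix.conjTranspose_submatrix, Matrix.conjTranspose_one]
  have := Matrix.submatrix_mul_equiv Q (1 : Matrix (Fin (r * dB)) (Fin (r * dB)) ℂ) finProdFinEquiv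
    (Equiv.refl (Fin (r * dB))) finProdFinEquiv
  rw [Matrix.mul_one] at this
  exact congrFun (congrFun this (j, y)) (i, y)

lemma traceOutB_one :
    traceOutB (1 : Matrix (Fin (r * dB)) (Fin (r * dB)) ℂ)
      = (dB : ℂ) • (1 : Matrix (Fin r) (Fin r) ℂ) := by
  ext i j
  by_cases h : i = j <;> simp [traceOutB, Matrix.one_apply, h]

lemma reshape_one_isometry (hr : 1 ≤ r) (hdB : 1 ≤ dB) :
    (reshape r dB 1)ᴴ * reshape r dB 1 = (r : ℂ)⁻¹ • (1 : Matrix (Fin r) (Fin r) ℂ) := by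
  have hd : (dB : ℂ) ≠ 0 := by exact_mod_cast (by omega : dB ≠ 0)
  have hr' : (r : ℂ) ≠ 0 := by exact_mod_cast (by omega : r ≠ 0)
  rw [reshape_one_conjTranspose_mul, traceOutB_one, Matrix.transpose_smul, Matrix.transpose_one,
    smul_smul]
  congr 1
  push_cast
  field_simp

lemma integral_trace_mul_reshape (O : Matrix (Fin (r * dB)) (Fin (r * dB)) ℂ)
    (A : Matrix (Fin r) (Fin (r * dB) × Fin dB) ℂ) :
    ∫ U, (A * reshape r dB (conjBy O U)).trace ∂haarU (r * dB)
      = O.trace / (r * dB : ℕ) * (A * reshape r dB 1).trace := by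
  generalize ht : O.trace = t
  simp only [Matrix.trace, Matrix.diag_apply, Matrix.mul_apply, reshape, choiFactor_apply,
    Matrix.submatrix_apply, id]
  rw [integral_finsetSum _ fun i _ => integrable_haarU (by fun_prop), Finset.mul_sum]
  refine Finset.sum_congr rfl fun i _ => ?_
  rw [integral_finsetSum _ fun i _ => integrable_haarU (by fun_prop), Finset.mul_sum]
  refine Finset.sum_congr rfl fun p _ => ?_
  rw [integral_const_mul, integral_const_mul, integral_conjBy_apply, Matrix.one_apply, ht, id]
  split_ifs
  · ring
  · ring

/-- For fixed `U₁`, testing against `W = (r/ε) K q₁† (1 - r K K†)`, where `K` and `q₁` are the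
reshapings of `1` and of `U₁ O U₁†`. The factor `1 - r K K†` removes the common part `K` of the two
Choi states, and also the mean of the part linear in `U₂ O U₂†`, which is a multiple of `K`. -/
lemma le_integral_choiDist_conjIsometry (hr : 1 ≤ r) (hdB : 1 ≤ dB) {ε θ : ℝ} (hε : 0 < ε)
    (U₁ : Matrix.unitaryGroup (Fin (r * dB)) ℂ)
    (hint : Integrable (fun U₂ => choiDist (conjIsometry r dB ε θ U₁) (conjIsometry r dB ε θ U₂))
      (haarU (r * dB)))
    (hfrob : frob (phaseDiag (r * dB) ε θ) ^ 2 ≤ ε ^ 2 * (r * dB : ℕ)) :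
    1 / ε * (frob (phaseDiag (r * dB) ε θ) ^ 2 / (r * dB : ℕ) - r / ((r * dB : ℕ) : ℝ) ^ 2 *
        frob (traceOutB (conjBy (phaseDiag (r * dB) ε θ) U₁)) ^ 2) - 2 * ε ^ 2
      ≤ ∫ U₂, choiDist (conjIsometry r dB ε θ U₁) (conjIsometry r dB ε θ U₂)
          ∂haarU (r * dB) := by
  have hrC : (r : ℂ) ≠ 0 := by exact_mod_cast (by omega : r ≠ 0)
  have hr0 : (0 : ℝ) < r := by exact_mod_cast hr
  have hεC : (ε : ℂ) ≠ 0 := by exact_mod_cast hε.ne'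
  have hNpos : (0 : ℝ) < (r * dB : ℕ) := by exact_mod_cast Nat.mul_pos hr hdB
  set O := phaseDiag (r * dB) ε θ with hO
  set K : Matrix (Fin (r * dB) × Fin dB) (Fin r) ℂ := reshape r dB 1 with hK
  have hKK : Kᴴ * K = (r : ℂ)⁻¹ • 1 := reshape_one_isometry hr hdB
  set q := fun U => (reshape r dB (conjBy O U) : Matrix (Fin (r * dB) × Fin dB) (Fin r) ℂ) with hq
  have hM : ∀ U, choiFactor (conjIsometry r dB ε θ U) = K + q U := by
    intro U
    rw [conjIsometry_eq, hK, hq, ← reshape_add, reshape]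
  set P : Matrix (Fin (r * dB) × Fin dB) (Fin (r * dB) × Fin dB) ℂ := 1 - (r : ℂ) • (K * Kᴴ) with hP
  have hPK : P * K = 0 := by
    rw [hP, Matrix.sub_mul, Matrix.one_mul, Matrix.smul_mul, Matrix.mul_assoc, hKK,
      Matrix.mul_smul, Matrix.mul_one, smul_smul, mul_inv_cancel₀ hrC, one_smul, sub_self]
  have hPP : Pᴴ * P = P := by
    have h1 : Pᴴ = P := by
      rw [hP, Matrix.conjTranspose_sub, Matrix.conjTranspose_one, Matrix.conjTranspose_smul,
        Matrix.conjTranspose_mul, Matrix.conjTranspose_conjTranspose]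
      simp
    rw [h1]
    calc P * P = P * 1 - (r : ℂ) • (P * K * Kᴴ) := by
          conv_lhs => rw [hP, Matrix.mul_sub, ← hP, Matrix.mul_smul, ← Matrix.mul_assoc]
      _ = P := by rw [hPK, Matrix.zero_mul, smul_zero, sub_zero, Matrix.mul_one]
  set W : Matrix (Fin (r * dB) × Fin dB) (Fin (r * dB) × Fin dB) ℂ :=
    ((r / ε : ℝ) : ℂ) • (K * (q U₁)ᴴ * P) with hW
  have hWK : W * K = 0 := by
    rw [hW, Matrix.smul_mul, Matrix.mul_assoc, hPK, Matrix.mul_zero, smul_zero]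
  have hW1 : ‖W‖ ≤ 1 := by
    have h1 : ‖K‖ ≤ 1 / Real.sqrt r := by
      refine (opNorm_reshape_le hr hdB 1).trans ?_
      gcongr
      exact opNorm_unitary_le 1
    have h2 : ‖(q U₁)ᴴ‖ ≤ ε / Real.sqrt r := by
      rw [Matrix.l2_opNorm_conjTranspose]
      refine (opNorm_reshape_le hr hdB _).trans ?_
      gcongr
      exact (opNorm_conjBy_le _ _).trans (opNorm_phaseDiag_le _ hε.le θ)
    have h3 : ‖P‖ ≤ 1 := opNorm_le_one_of_projection hPP
    have h4 : ‖K * (q U₁)ᴴ * P‖ ≤ (1 / Real.sqrt r) * (ε / Real.sqrt r) * 1 := by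
      refine (Matrix.l2_opNorm_mul _ _).trans ?_
      gcongr
      refine (Matrix.l2_opNorm_mul _ _).trans ?_
      gcongr
    rw [hW, norm_smul, Complex.norm_real, Real.norm_eq_abs, abs_of_pos (by positivity)]
    have h5 : (1 / Real.sqrt r) * (ε / Real.sqrt r) * 1 = ε / r := by
      rw [mul_one, div_mul_div_comm, one_mul, Real.mul_self_sqrt hr0.le]
    rw [h5] at h4
    calc r / ε * ‖K * (q U₁)ᴴ * P‖ ≤ r / ε * (ε / r) := by gcongr
      _ = 1 := by field_simp
  -- as `W K = 0`, only the terms of `M M†` with `q` on the left survive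
  have hWM : ∀ U, (W * ((K + q U) * (K + q U)ᴴ)).trace
      = (Kᴴ * W * q U).trace + (W * (q U * (q U)ᴴ)).trace := by
    intro U
    rw [← Matrix.mul_assoc, Matrix.mul_add, hWK, zero_add, Matrix.conjTranspose_add,
      Matrix.mul_add, Matrix.trace_add, Matrix.trace_mul_comm (W * q U), ← Matrix.mul_assoc,
      Matrix.mul_assoc W]
  have hquad : ∀ U, |(W * (q U * (q U)ᴴ)).trace.re| ≤ ε ^ 2 := by
    intro U
    refine (Complex.abs_re_le_norm _).trans ((norm_trace_mul_mul_le hW1 _ _).trans ?_)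
    rw [← sq, hq, frob_reshape_sq, frob_conjBy, div_le_iff₀ hNpos]
    exact hfrob
  have hpt : ∀ U₂, (Kᴴ * W * q U₁).trace.re - 2 * ε ^ 2 - (Kᴴ * W * q U₂).trace.re
      ≤ choiDist (conjIsometry r dB ε θ U₁) (conjIsometry r dB ε θ U₂) := by
    intro U₂
    rw [choiDist_eq, hM, hM]
    refine le_trans ?_ (re_trace_mul_le_traceNorm (isHermitian_sub_mul_conjTranspose _ _) hW1)
    rw [Matrix.mul_sub, Matrix.trace_sub, hWM, hWM, Complex.sub_re, Complex.add_re,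
      Complex.add_re]
    linarith [(abs_le.1 (hquad U₁)).1, (abs_le.1 (hquad U₂)).2]
  have hcont : Continuous fun U₂ => (Kᴴ * W * q U₂).trace := by
    generalize Kᴴ * W = A
    simp only [Matrix.trace, Matrix.diag_apply, Matrix.mul_apply, hq, reshape,
      choiFactor_apply, Matrix.submatrix_apply, id]
    fun_prop
  -- the mean of `q U₂` is a multiple of `K`, which `W` annihilates
  have hmean : ∫ U₂, (Kᴴ * W * q U₂).trace.re ∂haarU (r * dB) = 0 := by
    have h1 := integral_trace_mul_reshape O (Kᴴ * W)
    rw [← hK, Matrix.mul_assoc, hWK, Matrix.mul_zero, Matrix.trace_zero, mul_zero] at h1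
    have h2 := integral_re (𝕜 := ℂ) (integrable_haarU hcont)
    simp only [RCLike.re_eq_complex_re] at h2
    rw [h2]
    change (∫ U, (Kᴴ * W * reshape r dB (conjBy O U)).trace ∂haarU (r * dB)).re = 0
    rw [h1, Complex.zero_re]
  have hmain : (Kᴴ * W * q U₁).trace.re = 1 / ε * (frob O ^ 2 / (r * dB : ℕ)
      - r / ((r * dB : ℕ) : ℝ) ^ 2 * frob (traceOutB (conjBy O U₁)) ^ 2) := by
    have h1 : Kᴴ * W * q U₁ = ((1 / ε : ℝ) : ℂ) • ((q U₁)ᴴ * q U₁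
        - (r : ℂ) • ((Kᴴ * q U₁)ᴴ * (Kᴴ * q U₁))) := by
      rw [hW, Matrix.mul_smul, Matrix.smul_mul, ← Matrix.mul_assoc, ← Matrix.mul_assoc, hKK]
      simp only [Matrix.smul_mul, Matrix.one_mul, smul_smul]
      congr 1
      · push_cast
        field_simp
      · rw [hP, Matrix.mul_sub, Matrix.sub_mul, Matrix.mul_one, Matrix.conjTranspose_mul,
          Matrix.conjTranspose_conjTranspose]
        simp only [Matrix.mul_smul, Matrix.smul_mul, Matrix.mul_assoc]
    have h2 : frob (Kᴴ * q U₁) ^ 2 =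
        1 / ((r * dB : ℕ) : ℝ) ^ 2 * frob (traceOutB (conjBy O U₁)) ^ 2 := by
      have h3 : frob (traceOutB (conjBy O U₁))ᵀ = frob (traceOutB (conjBy O U₁)) := by
        rw [frob, frob, Finset.sum_comm]
        rfl
      rw [hK, hq, reshape_one_conjTranspose_mul, frob_smul, mul_pow, h3, norm_inv,
        Complex.norm_natCast, inv_pow, one_div]
    rw [h1, Matrix.trace_smul, Matrix.trace_sub, Matrix.trace_smul, trace_conjTranspose_mul,
      trace_conjTranspose_mul, h2, hq, frob_reshape_sq, frob_conjBy, smul_eq_mul, smul_eq_mul,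
      Complex.re_ofReal_mul, Complex.sub_re, Complex.ofReal_re, ← Complex.ofReal_natCast,
      Complex.re_ofReal_mul, Complex.ofReal_re]
    ring
  have hre : Integrable (fun U₂ => (Kᴴ * W * q U₂).trace.re) (haarU (r * dB)) :=
    integrable_haarU (Complex.continuous_re.comp hcont)
  have hfin := integral_mono ((integrable_const _).sub hre) hint hpt
  simp only [Pi.sub_apply] at hfin
  rw [integral_sub (integrable_const _) hre, hmean, hmain] at hfin
  simpa using hfin

end Conj

/-! ### Mean distance for the conjugated diagonal unitary -/

section ConjFinal

lemma sum_range_two_mul_alternating {E : Type*} [AddCommMonoid E] (x y : E) (m : ℕ) :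
    ∑ k ∈ Finset.range (2 * m), (if Even k then x else y) = m • (x + y) := by
  induction m with
  | zero => simp
  | succ m ih =>
    rw [show 2 * (m + 1) = 2 * m + 1 + 1 by ring, Finset.sum_range_succ, Finset.sum_range_succ, ih]
    have h1 : Even (2 * m) := even_two_mul m
    have h2 : ¬ Even (2 * m + 1) := by simp
    rw [if_pos h1, if_neg h2, succ_nsmul, add_assoc]

/-- The diagonal of `O` consists of `⌊d/2⌋` pairs `ε e^{±iθ}`, up to a zero. -/
lemma sum_phaseDiag {E : Type*} [AddCommMonoid E] (φ : ℂ → E) (h0 : φ 0 = 0) (d : ℕ) (ε θ : ℝ) :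
    ∑ k, φ (phaseDiag d ε θ k k) = (d / 2) •
      (φ ((ε : ℂ) * Complex.exp (Complex.I * θ))
        + φ ((ε : ℂ) * Complex.exp (-(Complex.I * θ)))) := by
  set x := φ ((ε : ℂ) * Complex.exp (Complex.I * θ))
  set y := φ ((ε : ℂ) * Complex.exp (-(Complex.I * θ)))
  have h1 : ∑ k, φ (phaseDiag d ε θ k k)
      = ∑ k ∈ Finset.range d, if Odd d ∧ k + 1 = d then 0 else if Even k then x else y := by
    rw [← Fin.sum_univ_eq_sum_range
      (fun k => if Odd d ∧ k + 1 = d then 0 else if Even k then x else y)]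
    refine Finset.sum_congr rfl fun k _ => ?_
    rw [phaseDiag, Matrix.diagonal_apply_eq]
    split_ifs <;> first | exact h0 | rfl
  rw [h1]
  rcases Nat.even_or_odd' d with ⟨m, rfl | rfl⟩
  · have h2 : ¬ Odd (2 * m) := by simp
    simp only [h2, false_and, if_false]
    rw [sum_range_two_mul_alternating, Nat.mul_div_cancel_left _ two_pos]
  · rw [Finset.sum_range_succ, if_pos ⟨odd_two_mul_add_one m, rfl⟩, add_zero,
      show (2 * m + 1) / 2 = m by omega, ← sum_range_two_mul_alternating]
    refine Finset.sum_congr rfl fun k hk => ?_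
    rw [if_neg]
    rw [Finset.mem_range] at hk
    omega

lemma frob_phaseDiag_sq (d : ℕ) (ε θ : ℝ) :
    frob (phaseDiag d ε θ) ^ 2 = 2 * (d / 2 : ℕ) * ε ^ 2 := by
  have h1 : ‖Complex.exp (Complex.I * θ)‖ = 1 := by rw [mul_comm, Complex.norm_exp_ofReal_mul_I]
  have h2 : ‖Complex.exp (-(Complex.I * θ))‖ = 1 := by
    rw [Complex.exp_neg, norm_inv, h1, inv_one]
  have h := sum_phaseDiag (fun z => ‖z‖ ^ 2) (by simp) d ε θ
  simp only [norm_mul, h1, h2, Complex.norm_real, Real.norm_eq_abs, mul_one, sq_abs,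
    nsmul_eq_mul] at h
  rw [frob_sq]
  calc _ = ∑ k, ‖phaseDiag d ε θ k k‖ ^ 2 := by
        refine Finset.sum_congr rfl fun k _ => Finset.sum_eq_single k (fun j _ hj => ?_) (by simp)
        rw [phaseDiag, Matrix.diagonal_apply_ne _ hj.symm]
        simp
    _ = _ := by rw [h]; ring

lemma norm_trace_phaseDiag_sq (d : ℕ) (ε θ : ℝ) (hε : ε = -2 * Real.cos θ) :
    ‖(phaseDiag d ε θ).trace‖ ^ 2 = ((d / 2 : ℕ) : ℝ) ^ 2 * ε ^ 4 := by
  have h := sum_phaseDiag (fun z => z) rfl d ε θ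
  have h1 : (ε : ℂ) * Complex.exp (Complex.I * θ) + (ε : ℂ) * Complex.exp (-(Complex.I * θ))
      = ((-ε ^ 2 : ℝ) : ℂ) := by
    have h2 : Complex.exp (Complex.I * θ) + Complex.exp (-(Complex.I * θ))
        = ((2 * Real.cos θ : ℝ) : ℂ) := by
      push_cast
      rw [Complex.two_cos, mul_comm, neg_mul]
    rw [← mul_add, h2, ← Complex.ofReal_mul]
    congr 1
    rw [hε]
    ring
  rw [h1] at h
  have h3 : (phaseDiag d ε θ).trace = (d / 2) • ((-ε ^ 2 : ℝ) : ℂ) := h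
  rw [h3, nsmul_eq_mul, norm_mul, Complex.norm_natCast, Complex.norm_real, Real.norm_eq_abs,
    mul_pow, sq_abs]
  ring

lemma choiDist_conjIsometry_lipschitz (r dB : ℕ) {ε θ : ℝ} (hε0 : 0 ≤ ε)
    (hε : ε = -2 * Real.cos θ) (U₁ U₂ U₁' U₂' : Matrix.unitaryGroup (Fin (r * dB)) ℂ) :
    |choiDist (conjIsometry r dB ε θ U₁) (conjIsometry r dB ε θ U₂)
        - choiDist (conjIsometry r dB ε θ U₁') (conjIsometry r dB ε θ U₂')|
      ≤ 4 * Real.sqrt (2 / ((r * dB : ℕ) : ℝ)) * ε *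
        Real.sqrt (hsNorm (U₁.1 - U₁'.1) ^ 2 + hsNorm (U₂.1 - U₂'.1) ^ 2) := by
  have h := choiDist_lipschitz_of_isometry hε0 (conjIsometry r dB ε θ)
    (fun U => by rw [hε]; exact conjIsometry_isometry r dB θ U)
    (fun U U' => frob_conjIsometry_sub_le r dB hε0 θ U U') U₁ U₂ U₁' U₂'
  rwa [Fintype.card_fin] at h

/-- The numerical part of the lower bound. Here `s = ‖O‖₂²` and `t = |Tr O|²`, and `I` is the mean
of `‖Tr_B (U O U†)‖₂²`. -/
lemma conjIsometry_moment_bound {N r dB m s t I ε : ℝ} (hN : 2 ≤ N) (hr : 0 ≤ r) (hrN : 2 * r ≤ N)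
    (hNmul : r * dB = N) (hm : 0 ≤ m) (hm1 : 2 * m ≤ N) (hm2 : N ≤ 2 * m + 1)
    (hs : s = 2 * m * ε ^ 2) (ht : t = m ^ 2 * ε ^ 4)
    (hI : (N ^ 2 - 1) * I = r * (N * s - t) + dB * (N * t - s))
    (hε0 : 0 < ε) (hsmall : ε < 1 / 10 ^ 4) :
    1 / 8 * ε ≤ 1 / ε * (s / N - r / N ^ 2 * I) - 2 * ε ^ 2 := by
  have hs0 : 0 ≤ s := by rw [hs]; positivity
  have ht0 : 0 ≤ t := by rw [ht]; positivity
  have hsle : s ≤ ε ^ 2 * N := by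
    rw [hs, mul_comm (ε ^ 2)]
    gcongr
  have hN0 : (0 : ℝ) < N := by linarith
  have hN1 : 0 < N ^ 2 - 1 := by nlinarith
  have hε2 : ε ^ 2 ≤ 1 / 10 ^ 8 := by nlinarith
  have hε3 : ε ^ 4 ≤ ε ^ 2 * (1 / 10 ^ 8) := by nlinarith [sq_nonneg ε]
  -- `r · 𝔼 ‖Tr_B Q‖² ≤ N² ε² (1 + ε²) / 3`, which is less than `N ‖O‖₂² ≥ N² ε² / 2`
  have hrI : r * I ≤ N ^ 2 * (ε ^ 2 * (1 + 1 / 10 ^ 8) / 3) := by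
    have h2 : (N ^ 2 - 1) * (r * I) = r ^ 2 * (N * s) + N ^ 2 * t - r ^ 2 * t - N * s := by
      calc (N ^ 2 - 1) * (r * I) = r * ((N ^ 2 - 1) * I) := by ring
        _ = r * (r * (N * s - t) + dB * (N * t - s)) := by rw [hI]
        _ = r ^ 2 * (N * s - t) + (r * dB) * (N * t - s) := by ring
        _ = _ := by rw [hNmul]; ring
    have h3 : 0 ≤ r ^ 2 * t := by positivity
    have h4 : 0 ≤ N * s := by positivity
    have h5 : r ^ 2 ≤ N ^ 2 / 4 := by nlinarith
    have h6 : t ≤ N ^ 2 / 4 * (ε ^ 2 * (1 / 10 ^ 8)) := by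
      rw [ht]
      have : m ^ 2 ≤ N ^ 2 / 4 := by nlinarith
      gcongr
    have h7 : r ^ 2 * (N * s) ≤ N ^ 2 / 4 * (N * (ε ^ 2 * N)) := by gcongr
    have h8 : N ^ 2 * t ≤ N ^ 2 * (N ^ 2 / 4 * (ε ^ 2 * (1 / 10 ^ 8))) := by gcongr
    have h10 : N ^ 2 ≤ 4 / 3 * (N ^ 2 - 1) := by nlinarith
    have h11 : 0 ≤ N ^ 2 * (ε ^ 2 * (1 + 1 / 10 ^ 8) / 4) := by positivity
    have h12 := mul_le_mul_of_nonneg_left h10 h11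
    have h9 : (N ^ 2 - 1) * (r * I) ≤ (N ^ 2 - 1) * (N ^ 2 * (ε ^ 2 * (1 + 1 / 10 ^ 8) / 3)) := by
      linarith
    exact le_of_mul_le_mul_left h9 hN1
  have hA : r / N ^ 2 * I ≤ ε ^ 2 * (1 + 1 / 10 ^ 8) / 3 := by
    rw [div_mul_eq_mul_div, div_le_iff₀ (by positivity)]
    linarith
  have hB : ε ^ 2 / 2 ≤ s / N := by
    rw [le_div_iff₀ hN0, hs]
    have := mul_nonneg (sq_nonneg ε) (by linarith : (0 : ℝ) ≤ 2 * m - N / 2)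
    linarith
  have hC : 1 / ε * (ε ^ 2 / 2 - ε ^ 2 * (1 + 1 / 10 ^ 8) / 3)
      ≤ 1 / ε * (s / N - r / N ^ 2 * I) := by gcongr
  have hD : 1 / ε * (ε ^ 2 / 2 - ε ^ 2 * (1 + 1 / 10 ^ 8) / 3)
      = ε * (1 / 2 - (1 + 1 / 10 ^ 8) / 3) := by
    field_simp
  rw [hD] at hC
  nlinarith

lemma le_integral_prod_choiDist_conjIsometry {r dB : ℕ} (hr : 1 ≤ r) (hdB : 2 ≤ dB) {ε θ : ℝ}
    (hε0 : 0 < ε) (hε : ε = -2 * Real.cos θ) (hsmall : ε < 1 / 10 ^ 4) :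
    1 / 8 * ε ≤ ∫ U, choiDist (conjIsometry r dB ε θ U.1) (conjIsometry r dB ε θ U.2)
      ∂((haarU (r * dB)).prod (haarU (r * dB))) := by
  have hN2 : 2 ≤ r * dB := hdB.trans (Nat.le_mul_of_pos_left dB hr)
  have hs := frob_phaseDiag_sq (r * dB) ε θ
  have ht := norm_trace_phaseDiag_sq (r * dB) ε θ hε
  have hI := integral_frob_traceOutB hN2 (phaseDiag (r * dB) ε θ)
  have hm1 : 2 * ((r * dB / 2 : ℕ) : ℝ) ≤ (r * dB : ℕ) := by
    exact_mod_cast Nat.mul_div_le (r * dB) 2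
  have hm2 : ((r * dB : ℕ) : ℝ) ≤ 2 * ((r * dB / 2 : ℕ) : ℝ) + 1 := by
    exact_mod_cast (by omega : r * dB ≤ 2 * (r * dB / 2) + 1)
  have hrN : 2 * (r : ℝ) ≤ (r * dB : ℕ) := by
    exact_mod_cast (by nlinarith : 2 * r ≤ r * dB)
  have hnum := conjIsometry_moment_bound (by exact_mod_cast hN2) (Nat.cast_nonneg r) hrN
    (Nat.cast_mul r dB).symm (Nat.cast_nonneg _) hm1 hm2 hs ht hI hε0 hsmall
  have hsle : frob (phaseDiag (r * dB) ε θ) ^ 2 ≤ ε ^ 2 * (r * dB : ℕ) := by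
    rw [hs, mul_comm (ε ^ 2)]
    gcongr
  have hcont : Continuous fun U : Matrix.unitaryGroup (Fin (r * dB)) ℂ ×
      Matrix.unitaryGroup (Fin (r * dB)) ℂ =>
      choiDist (conjIsometry r dB ε θ U.1) (conjIsometry r dB ε θ U.2) :=
    continuous_of_hsNorm_lipschitz _ fun U U' =>
      choiDist_conjIsometry_lipschitz r dB hε0.le hε U.1 U.2 U'.1 U'.2
  have hcf := continuous_frob_sq_traceOutB (phaseDiag (r * dB) ε θ)
  have hsec : ∀ U₁, Integrable (fun U₂ => choiDist (conjIsometry r dB ε θ U₁)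
      (conjIsometry r dB ε θ U₂)) (haarU (r * dB)) := fun U₁ =>
    integrable_section_haarU
      (f := fun U₁ U₂ => choiDist (conjIsometry r dB ε θ U₁) (conjIsometry r dB ε θ U₂)) hcont U₁
  have hlow := integral_le_integral_prod_haarU
    (f := fun U₁ U₂ => choiDist (conjIsometry r dB ε θ U₁) (conjIsometry r dB ε θ U₂)) hcont
    (g := fun U => 1 / ε * (frob (phaseDiag (r * dB) ε θ) ^ 2 / (r * dB : ℕ)
      - r / ((r * dB : ℕ) : ℝ) ^ 2 * frob (traceOutB (conjBy (phaseDiag (r * dB) ε θ) U)) ^ 2)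
      - 2 * ε ^ 2)
    (((continuous_const.sub (hcf.const_mul _)).const_mul _).sub continuous_const)
    fun U₁ => le_integral_choiDist_conjIsometry hr (one_le_two.trans hdB) hε0 U₁ (hsec U₁) hsle
  refine (hnum.trans (le_of_eq ?_)).trans hlow
  have hint : Integrable (fun U => r / ((r * dB : ℕ) : ℝ) ^ 2 *
      frob (traceOutB (conjBy (phaseDiag (r * dB) ε θ) U)) ^ 2) (haarU (r * dB)) :=
    (integrable_haarU hcf).const_mul _
  have hint' : Integrable (fun U => 1 / ε * (frob (phaseDiag (r * dB) ε θ) ^ 2 / (r * dB : ℕ)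
      - r / ((r * dB : ℕ) : ℝ) ^ 2 * frob (traceOutB (conjBy (phaseDiag (r * dB) ε θ) U)) ^ 2))
      (haarU (r * dB)) := ((integrable_const _).sub hint).const_mul _
  rw [integral_sub hint' (integrable_const _), integral_const_mul,
    integral_sub (integrable_const _) hint, integral_const_mul]
  simp only [integral_const, probReal_univ, one_smul]

end ConjFinal

/-! ### Mean distance for the flagged isometry -/

section FlagFinal

open scoped Matrix.Norms.L2Operator

/-- The trace norm dominates the pairing of any contraction with any block. -/
lemma re_trace_mul_submatrix_le_traceNorm {m n : Type*} [Fintype m] [DecidableEq m] [Fintype n]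
    [DecidableEq n] {X : Matrix n n ℂ} (hX : X.IsHermitian) {g₀ g₁ : m → n}
    (h₀ : Function.Injective g₀) (h₁ : Function.Injective g₁) {W : Matrix m m ℂ} (hW : ‖W‖ ≤ 1) :
    (W * X.submatrix g₀ g₁).trace.re ≤ traceNorm X := by
  have hiso : ∀ g : m → n, Function.Injective g →
      ‖(1 : Matrix n n ℂ).submatrix id g‖ ≤ 1 := by
    intro g hg
    refine opNorm_le_one_of_conjTranspose_mul ?_
    ext i j
    simp [Matrix.mul_apply, Matrix.one_apply, hg.eq_iff, eq_comm]
  have h2 : X.submatrix g₀ g₁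
      = ((1 : Matrix n n ℂ).submatrix id g₀)ᴴ * X * (1 : Matrix n n ℂ).submatrix id g₁ := by
    ext i j
    simp [Matrix.mul_apply, Matrix.one_apply]
  have h3 : (W * X.submatrix g₀ g₁).trace = ((1 : Matrix n n ℂ).submatrix id g₁ * W *
      ((1 : Matrix n n ℂ).submatrix id g₀)ᴴ * X).trace := by
    rw [h2, ← Matrix.mul_assoc, Matrix.trace_mul_comm]
    simp only [Matrix.mul_assoc]
  rw [h3]
  refine re_trace_mul_le_traceNorm hX (opNorm_mul_le_one (opNorm_mul_le_one (hiso g₁ h₁) hW) ?_)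
  rw [Matrix.l2_opNorm_conjTranspose]
  exact hiso g₀ h₀

variable {dA dB r : ℕ}

lemma choiDist_flagIsometry_lipschitz (h : dA ≤ r * dB)
    {K : Fin r → Matrix (Fin dB) (Fin dA) ℂ} (hK : IsBalancedKraus K) {ε : ℝ} (hε0 : 0 ≤ ε)
    (hε1 : ε ≤ 1) (U₁ U₂ U₁' U₂' : Matrix.unitaryGroup (Fin (r * dB)) ℂ) :
    |choiDist (flagIsometry K ε U₁) (flagIsometry K ε U₂)
        - choiDist (flagIsometry K ε U₁') (flagIsometry K ε U₂')|
      ≤ 4 * Real.sqrt (2 / (dA : ℝ)) * ε *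
        Real.sqrt (hsNorm (U₁.1 - U₁'.1) ^ 2 + hsNorm (U₂.1 - U₂'.1) ^ 2) := by
  have h := choiDist_lipschitz_of_isometry hε0 (flagIsometry K ε)
    (flagIsometry_isometry h hK hε0 hε1) (frob_flagIsometry_sub_le h K hε0) U₁ U₂ U₁' U₂'
  rwa [Fintype.card_fin] at h

/-- The off-diagonal block, with respect to the flag `F`, of the Choi state. -/
lemma choiState_flagIsometry_block (K : Fin r → Matrix (Fin dB) (Fin dA) ℂ) (ε : ℝ)
    (U : Matrix.unitaryGroup (Fin (r * dB)) ℂ) :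
    (choiFactor (flagIsometry K ε U) * (choiFactor (flagIsometry K ε U))ᴴ).submatrix
        (fun p : Fin dA × Fin dB => (p.1, ((0 : Fin 2), p.2)))
        (fun p : Fin dA × Fin dB => (p.1, ((1 : Fin 2), p.2)))
      = ((Real.sqrt (1 - ε ^ 2) * ε : ℝ) : ℂ) •
        (choiFactor (krausIsometry K) * (choiFactor (haarIsometry dA dB r U))ᴴ) := by
  ext p q
  simp only [Matrix.submatrix_apply, Matrix.smul_apply, Matrix.mul_apply, smul_eq_mul,
    Finset.mul_sum, Matrix.conjTranspose_apply, choiFactor_apply, flagIsometry, Matrix.of_apply]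
  refine Finset.sum_congr rfl fun i _ => ?_
  simp
  ring

lemma choiFactor_krausIsometry_gram {K : Fin r → Matrix (Fin dB) (Fin dA) ℂ}
    (hK : IsBalancedKraus K) :
    (choiFactor (krausIsometry K))ᴴ * choiFactor (krausIsometry K)
      = Matrix.diagonal fun i => ((frob (K i) ^ 2 / dA : ℝ) : ℂ) := by
  ext i j
  have h1 : ((choiFactor (krausIsometry K))ᴴ * choiFactor (krausIsometry K)) i j
      = (dA : ℂ)⁻¹ * ((K i)ᴴ * K j).trace := by
    rw [conjTranspose_choiFactor_mul_apply, Fintype.card_fin, Matrix.trace_mul_comm]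
    rfl
  rw [h1]
  by_cases hij : i = j
  · subst hij
    rw [Matrix.diagonal_apply_eq, trace_conjTranspose_mul]
    push_cast
    ring
  · have h2 := hK.trace_le i j
    rw [if_neg hij] at h2
    rw [Matrix.diagonal_apply_ne _ hij, norm_le_zero_iff.1 h2, mul_zero]

lemma krausWeight_le (hdA : 1 ≤ dA) {K : Fin r → Matrix (Fin dB) (Fin dA) ℂ}
    (hK : IsBalancedKraus K) (i : Fin r) : frob (K i) ^ 2 / dA ≤ 2 / r := by
  have h := hK.trace_le i i
  have hd : (0 : ℝ) < dA := by exact_mod_cast hdA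
  rw [if_pos rfl, trace_conjTranspose_mul, Complex.norm_real, Real.norm_eq_abs,
    abs_of_nonneg (sq_nonneg _)] at h
  rw [div_le_iff₀ hd]
  calc _ ≤ _ := h
    _ = _ := by ring

lemma sum_krausWeight (hdA : 1 ≤ dA) {K : Fin r → Matrix (Fin dB) (Fin dA) ℂ}
    (hK : IsBalancedKraus K) : ∑ i, frob (K i) ^ 2 / (dA : ℝ) = 1 := by
  have hd : (dA : ℝ) ≠ 0 := by positivity
  have h := congrArg Matrix.trace hK.complete
  rw [Matrix.trace_sum, Matrix.trace_one, Fintype.card_fin] at h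
  simp only [trace_conjTranspose_mul] at h
  have h1 : ∑ i, frob (K i) ^ 2 = (dA : ℝ) := by exact_mod_cast h
  rw [← Finset.sum_div, h1, div_self hd]

/-- The balance condition forces `r ≤ 2 d_A d_B`: the reshaped Kraus isometry `M` has orthogonal
columns of squared norm at most `2/r`, so `1 = (Tr MM†)² ≤ d_A d_B Tr (MM†)² ≤ d_A d_B · 2/r`. -/
lemma card_kraus_le (hdA : 1 ≤ dA) (hr : 1 ≤ r) {K : Fin r → Matrix (Fin dB) (Fin dA) ℂ}
    (hK : IsBalancedKraus K) : (r : ℝ) ≤ 2 * (dA * dB) := by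
  have hr0 : (0 : ℝ) < r := by exact_mod_cast hr
  set κ : Fin r → ℝ := fun i => frob (K i) ^ 2 / dA with hκ
  have hsum : ∑ i, κ i = 1 := sum_krausWeight hdA hK
  have hκ0 : ∀ i, 0 ≤ κ i := fun i => by positivity
  have hgram := choiFactor_krausIsometry_gram hK
  set M := choiFactor (krausIsometry K)
  have h1 : ((M * Mᴴ) * (1 : Matrix (Fin dA × Fin dB) (Fin dA × Fin dB) ℂ)).trace = 1 := by
    rw [Matrix.mul_one, Matrix.trace_mul_comm, hgram, Matrix.trace_diagonal]
    exact_mod_cast hsum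
  have h2 := norm_trace_mul_le (M * Mᴴ) (1 : Matrix (Fin dA × Fin dB) (Fin dA × Fin dB) ℂ)
  rw [h1, norm_one] at h2
  have h3 : frob (M * Mᴴ) ^ 2 = ∑ i, κ i ^ 2 := by
    have h4 := trace_conjTranspose_mul (M * Mᴴ)
    rw [Matrix.conjTranspose_mul, Matrix.conjTranspose_conjTranspose, Matrix.mul_assoc,
      Matrix.trace_mul_comm, Matrix.mul_assoc, Matrix.mul_assoc, hgram, ← Matrix.mul_assoc, hgram,
      Matrix.diagonal_mul_diagonal, Matrix.trace_diagonal] at h4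
    have h5 : ∑ i, κ i * κ i = frob (M * Mᴴ) ^ 2 := by exact_mod_cast h4
    rw [← h5]
    exact Finset.sum_congr rfl fun i _ => (sq _).symm
  have h6 : frob (1 : Matrix (Fin dA × Fin dB) (Fin dA × Fin dB) ℂ) ^ 2 = dA * dB := by
    have h7 := trace_conjTranspose_mul (1 : Matrix (Fin dA × Fin dB) (Fin dA × Fin dB) ℂ)
    rw [Matrix.conjTranspose_one, Matrix.one_mul, Matrix.trace_one, Fintype.card_prod,
      Fintype.card_fin, Fintype.card_fin] at h7
    exact_mod_cast h7.symm
  have h8 : ∑ i, κ i ^ 2 ≤ 2 / r := by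
    calc ∑ i, κ i ^ 2 ≤ ∑ i, 2 / (r : ℝ) * κ i := Finset.sum_le_sum fun i _ => by
          rw [sq]
          exact mul_le_mul_of_nonneg_right (krausWeight_le hdA hK i) (hκ0 i)
      _ = 2 / r := by rw [← Finset.mul_sum, hsum, mul_one]
  have h9 : (1 : ℝ) ≤ 2 / r * (dA * dB) := by
    have h10 : (1 : ℝ) ≤ (frob (M * Mᴴ) * frob (1 : Matrix (Fin dA × Fin dB) _ ℂ)) ^ 2 :=
      one_le_pow₀ h2
    rw [mul_pow, h3, h6] at h10
    refine h10.trans ?_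
    gcongr
  rw [div_mul_eq_mul_div, le_div_iff₀ hr0, one_mul] at h9
  exact h9

/-- The projection `S S†`. -/
noncomputable def embedProj (N dA : ℕ) : Matrix (Fin N) (Fin N) ℂ :=
  embedFirst N dA * (embedFirst N dA)ᴴ

lemma trace_embedProj {N : ℕ} (h : dA ≤ N) : (embedProj N dA).trace = dA := by
  rw [embedProj, Matrix.trace_mul_comm, embedFirst_isometry h, Matrix.trace_one, Fintype.card_fin]

lemma frob_embedProj_sq {N : ℕ} (h : dA ≤ N) : frob (embedProj N dA) ^ 2 = dA := by
  have h1 := trace_conjTranspose_mul (embedProj N dA)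
  have h2 : (embedProj N dA)ᴴ * embedProj N dA = embedProj N dA := by
    rw [embedProj, Matrix.conjTranspose_mul, Matrix.conjTranspose_conjTranspose, Matrix.mul_assoc,
      ← Matrix.mul_assoc (embedFirst N dA)ᴴ, embedFirst_isometry h, Matrix.one_mul]
  rw [h2, trace_embedProj h] at h1
  exact_mod_cast h1.symm

lemma choiFactor_haarIsometry_gram (U : Matrix.unitaryGroup (Fin (r * dB)) ℂ) :
    (choiFactor (haarIsometry dA dB r U))ᴴ * choiFactor (haarIsometry dA dB r U)
      = (dA : ℂ)⁻¹ • (traceOutB (conjBy (embedProj (r * dB) dA) U))ᵀ := by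
  ext i j
  rw [conjTranspose_choiFactor_mul_apply, Fintype.card_fin, Matrix.smul_apply, smul_eq_mul,
    Matrix.transpose_apply, traceOutB, Matrix.of_apply]
  congr 1
  have h : haarIsometry dA dB r U * (haarIsometry dA dB r U)ᴴ
      = (conjBy (embedProj (r * dB) dA) U).submatrix finProdFinEquiv finProdFinEquiv := by
    rw [haarIsometry, Matrix.conjTranspose_submatrix]
    have := Matrix.submatrix_mul_equiv (U.1 * embedFirst (r * dB) dA)
      (U.1 * embedFirst (r * dB) dA)ᴴ finProdFinEquiv (Equiv.refl _) finProdFinEquiv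
    refine this.trans ?_
    rw [conjBy, embedProj, Matrix.conjTranspose_mul]
    simp only [Matrix.mul_assoc]
  rw [h]
  rfl

lemma haarIsometry_apply (U : Matrix.unitaryGroup (Fin (r * dB)) ℂ) (p : Fin r × Fin dB)
    (x : Fin dA) :
    haarIsometry dA dB r U p x = ∑ k, U.1 (finProdFinEquiv p) k * embedFirst (r * dB) dA k x := rfl

@[fun_prop]
lemma continuous_haarIsometry_apply (p : Fin r × Fin dB) (x : Fin dA) :
    Continuous fun U => haarIsometry dA dB r U p x := by
  simp only [haarIsometry_apply]
  exact continuous_finsetSum _ fun k _ =>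
    (continuous_unitary_coe.matrix_elem _ k).mul continuous_const

lemma integral_haarIsometry_apply (p : Fin r × Fin dB) (x : Fin dA) :
    ∫ U, haarIsometry dA dB r U p x ∂haarU (r * dB) = 0 := by
  simp only [haarIsometry_apply]
  have hi : ∀ k ∈ Finset.univ, Integrable (fun U : Matrix.unitaryGroup (Fin (r * dB)) ℂ =>
      U.1 (finProdFinEquiv p) k * embedFirst (r * dB) dA k x) (haarU (r * dB)) := fun k _ =>
    integrable_haarU ((continuous_unitary_coe.matrix_elem _ k).mul continuous_const)
  rw [integral_finsetSum _ hi]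
  refine Finset.sum_eq_zero fun k _ => ?_
  rw [integral_mul_const, integral_unitary_apply, zero_mul]

lemma integral_trace_choiFactor_haarIsometry_mul (A : Matrix (Fin r) (Fin dA × Fin dB) ℂ) :
    ∫ U, (choiFactor (haarIsometry dA dB r U) * A).trace ∂haarU (r * dB) = 0 := by
  simp only [Matrix.trace, Matrix.diag_apply, Matrix.mul_apply, choiFactor_apply]
  rw [integral_finsetSum _ fun i _ => integrable_haarU (by fun_prop)]
  refine Finset.sum_eq_zero fun i _ => ?_
  rw [integral_finsetSum _ fun i _ => integrable_haarU (by fun_prop)]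
  refine Finset.sum_eq_zero fun p _ => ?_
  rw [integral_mul_const, integral_const_mul, integral_haarIsometry_apply, mul_zero, zero_mul]

lemma continuous_trace_choiFactor_haarIsometry_mul (A : Matrix (Fin r) (Fin dA × Fin dB) ℂ) :
    Continuous fun U => (choiFactor (haarIsometry dA dB r U) * A).trace := by
  simp only [Matrix.trace, Matrix.diag_apply, Matrix.mul_apply, choiFactor_apply]
  fun_prop

/-- A lower bound for `‖∑ᵢ |kᵢ⟩⟨uᵢ|‖₁`, in terms of the reduced operator of `U S S† U†` on `E`,
where `kᵢ` and `uᵢ` are the columns of the two reshaped isometries. -/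
lemma exists_contraction_flag (hdA : 1 ≤ dA) (hr : 1 ≤ r)
    {K : Fin r → Matrix (Fin dB) (Fin dA) ℂ} (hK : IsBalancedKraus K)
    (U : Matrix.unitaryGroup (Fin (r * dB)) ℂ) :
    ∃ W : Matrix (Fin dA × Fin dB) (Fin dA × Fin dB) ℂ, ‖W‖ ≤ 1 ∧
      3 * r / 8 * (∑ i, frob (K i) ^ 2 / dA *
          ((dA : ℝ)⁻¹ * (traceOutB (conjBy (embedProj (r * dB) dA) U) i i).re))
        - r / (32 * dA ^ 2) * frob (traceOutB (conjBy (embedProj (r * dB) dA) U)) ^ 2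
      ≤ (W * (choiFactor (krausIsometry K) * (choiFactor (haarIsometry dA dB r U))ᴴ)).trace.re := by
  have hr0 : (0 : ℝ) < r := by exact_mod_cast hr
  have hgram := choiFactor_krausIsometry_gram hK
  have hG := choiFactor_haarIsometry_gram (dA := dA) U
  set T := traceOutB (conjBy (embedProj (r * dB) dA) U)
  set M := choiFactor (krausIsometry K)
  set u := choiFactor (haarIsometry dA dB r U)
  set κ : Fin r → ℝ := fun i => frob (K i) ^ 2 / dA with hκ
  have hκ0 : ∀ i, 0 ≤ κ i := fun i => by positivity
  have hκ2 : ∀ i, κ i ≤ 2 / r := krausWeight_le hdA hK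
  obtain ⟨W, hW, hWle⟩ := exists_contraction_moment_le (M * uᴴ) (s := 4 / (r : ℝ)) (by positivity)
  refine ⟨W, hW, le_trans ?_ hWle⟩
  have hY : (M * uᴴ)ᴴ * (M * uᴴ) = u * (Matrix.diagonal fun i => (κ i : ℂ)) * uᴴ := by
    rw [Matrix.conjTranspose_mul, Matrix.conjTranspose_conjTranspose, Matrix.mul_assoc u,
      ← Matrix.mul_assoc Mᴴ, hgram, Matrix.mul_assoc]
  have htr1 : ((M * uᴴ)ᴴ * (M * uᴴ)).trace.re = ∑ i, κ i * ((dA : ℝ)⁻¹ * (T i i).re) := by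
    rw [hY, Matrix.trace_mul_comm, ← Matrix.mul_assoc, hG, Matrix.trace, Complex.re_sum]
    refine Finset.sum_congr rfl fun i _ => ?_
    rw [Matrix.diag_apply, Matrix.mul_diagonal, Matrix.smul_apply, Matrix.transpose_apply,
      smul_eq_mul, mul_comm, Complex.re_ofReal_mul, ← Complex.ofReal_natCast, ← Complex.ofReal_inv,
      Complex.re_ofReal_mul]
  have htr2 : ((M * uᴴ)ᴴ * (M * uᴴ) * ((M * uᴴ)ᴴ * (M * uᴴ))).trace.re
      ≤ (2 / r) ^ 2 * frob (uᴴ * u) ^ 2 := by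
    have hherm : (uᴴ * u).IsHermitian := Matrix.isHermitian_conjTranspose_mul_self u
    set D : Matrix (Fin r) (Fin r) ℂ := Matrix.diagonal fun i => (κ i : ℂ) with hD
    have h1 : ((M * uᴴ)ᴴ * (M * uᴴ) * ((M * uᴴ)ᴴ * (M * uᴴ))).trace
        = (D * (uᴴ * u) * (D * (uᴴ * u))).trace := by
      rw [hY]
      have : u * D * uᴴ * (u * D * uᴴ) = u * (D * (uᴴ * u) * (D * uᴴ)) := by
        simp only [Matrix.mul_assoc]
      rw [this, Matrix.trace_mul_comm]
      simp only [Matrix.mul_assoc]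
    rw [h1, Matrix.trace, Complex.re_sum, frob_sq, Finset.mul_sum]
    refine Finset.sum_le_sum fun i _ => ?_
    rw [Matrix.diag_apply, Matrix.mul_apply, Complex.re_sum, Finset.mul_sum]
    refine Finset.sum_le_sum fun j _ => ?_
    have h2 : (uᴴ * u) j i = star ((uᴴ * u) i j) := (hherm.apply j i).symm
    rw [hD, Matrix.diagonal_mul, Matrix.diagonal_mul, h2]
    have h3 : (κ i : ℂ) * (uᴴ * u) i j * ((κ j : ℂ) * star ((uᴴ * u) i j))
        = ((κ i * κ j * ‖(uᴴ * u) i j‖ ^ 2 : ℝ) : ℂ) := by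
      push_cast
      rw [← Complex.mul_conj', RCLike.star_def]
      ring
    rw [h3, Complex.ofReal_re, sq (2 / (r : ℝ))]
    have := hκ0 i
    have := hκ0 j
    gcongr
    · exact hκ2 i
    · exact hκ2 j
  have hGT : frob (uᴴ * u) ^ 2 = ((dA : ℝ) ^ 2)⁻¹ * frob T ^ 2 := by
    have h3 : frob Tᵀ = frob T := by
      rw [frob, frob, Finset.sum_comm]
      rfl
    rw [hG, frob_smul, mul_pow, h3, norm_inv, Complex.norm_natCast, inv_pow]
  rw [hGT] at htr2
  rw [htr1]
  have e1 : 3 / (2 * (4 / (r : ℝ))) = 3 * r / 8 := by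
    field_simp
    norm_num
  have e2 : 1 / (2 * (4 / (r : ℝ)) ^ 3) * ((2 / r) ^ 2 * (((dA : ℝ) ^ 2)⁻¹ * frob T ^ 2))
      = r / (32 * dA ^ 2) * frob T ^ 2 := by
    have hd : (dA : ℝ) ≠ 0 := by positivity
    field_simp
    ring
  rw [e1, ← e2]
  gcongr

/-- For fixed `U₁`, testing the difference of the Choi states against a contraction supported on
the off-diagonal block of the flag; the contribution of `U₂`, linear in `U₂`, averages to zero. -/
lemma le_integral_choiDist_flagIsometry (hdA : 1 ≤ dA) (hr : 1 ≤ r)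
    {K : Fin r → Matrix (Fin dB) (Fin dA) ℂ} (hK : IsBalancedKraus K) {ε : ℝ} (hε0 : 0 ≤ ε)
    (U₁ : Matrix.unitaryGroup (Fin (r * dB)) ℂ)
    (hint : Integrable (fun U₂ => choiDist (flagIsometry K ε U₁) (flagIsometry K ε U₂))
      (haarU (r * dB))) :
    Real.sqrt (1 - ε ^ 2) * ε * (3 * r / 8 * (∑ i, frob (K i) ^ 2 / dA *
          ((dA : ℝ)⁻¹ * (traceOutB (conjBy (embedProj (r * dB) dA) U₁) i i).re))
        - r / (32 * dA ^ 2) * frob (traceOutB (conjBy (embedProj (r * dB) dA) U₁)) ^ 2)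
      ≤ ∫ U₂, choiDist (flagIsometry K ε U₁) (flagIsometry K ε U₂) ∂haarU (r * dB) := by
  obtain ⟨W, hW, hWle⟩ := exists_contraction_flag hdA hr hK U₁
  set c := Real.sqrt (1 - ε ^ 2) * ε with hc
  have hc0 : 0 ≤ c := by positivity
  set M := choiFactor (krausIsometry K) with hM
  set u := fun U => choiFactor (haarIsometry dA dB r U) with hu
  have hswap : ∀ U, (W * (M * (u U)ᴴ)).trace.re = (u U * (W * M)ᴴ).trace.re := by
    intro U
    have : u U * (W * M)ᴴ = (W * (M * (u U)ᴴ))ᴴ := by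
      rw [← Matrix.mul_assoc, Matrix.conjTranspose_mul (W * M), Matrix.conjTranspose_conjTranspose]
    rw [this, Matrix.trace_conjTranspose, RCLike.star_def, Complex.conj_re]
  have hpt : ∀ U₂, c * (W * (M * (u U₁)ᴴ)).trace.re - c * (u U₂ * (W * M)ᴴ).trace.re
      ≤ choiDist (flagIsometry K ε U₁) (flagIsometry K ε U₂) := by
    intro U₂
    rw [choiDist_eq]
    refine le_trans (le_of_eq ?_) (re_trace_mul_submatrix_le_traceNorm
      (isHermitian_sub_mul_conjTranspose _ _)
      (g₀ := fun p : Fin dA × Fin dB => (p.1, ((0 : Fin 2), p.2)))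
      (g₁ := fun p : Fin dA × Fin dB => (p.1, ((1 : Fin 2), p.2)))
      (fun p q h => by simpa [Prod.ext_iff] using h)
      (fun p q h => by simpa [Prod.ext_iff] using h) hW)
    rw [Matrix.submatrix_sub, Pi.sub_apply, Pi.sub_apply, choiState_flagIsometry_block,
      choiState_flagIsometry_block, Matrix.mul_sub, Matrix.mul_smul, Matrix.mul_smul,
      Matrix.trace_sub, Matrix.trace_smul, Matrix.trace_smul, Complex.sub_re, smul_eq_mul,
      smul_eq_mul, Complex.re_ofReal_mul, Complex.re_ofReal_mul, ← hswap]
  have hcont := continuous_trace_choiFactor_haarIsometry_mul (W * M)ᴴ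
  have hmean : ∫ U₂, (u U₂ * (W * M)ᴴ).trace.re ∂haarU (r * dB) = 0 := by
    have h2 := integral_re (𝕜 := ℂ) (integrable_haarU hcont)
    simp only [RCLike.re_eq_complex_re] at h2
    rw [h2, integral_trace_choiFactor_haarIsometry_mul, Complex.zero_re]
  have hre : Integrable (fun U₂ => c * (u U₂ * (W * M)ᴴ).trace.re) (haarU (r * dB)) :=
    (integrable_haarU (Complex.continuous_re.comp hcont)).const_mul c
  have hfin := integral_mono ((integrable_const _).sub hre) hint hpt
  simp only [Pi.sub_apply] at hfin
  rw [integral_sub (integrable_const _) hre, integral_const_mul (μ := haarU (r * dB)) c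
    (fun U₂ => (u U₂ * (W * M)ᴴ).trace.re), hmean] at hfin
  simp only [integral_const, probReal_univ, one_smul, mul_zero, sub_zero] at hfin
  exact (mul_le_mul_of_nonneg_left hWle hc0).trans hfin

/-- The numerical part of the lower bound: `I` is the mean of `‖Tr_B (U S S† U†)‖₂²`, which is at
most `4 d_A² / r`. -/
lemma flagIsometry_moment_bound {N r dA dB I ε : ℝ} (hN : 2 ≤ N) (hr : 1 ≤ r) (hdA : 1 ≤ dA)
    (hNmul : r * dB = N) (hcard : r ≤ 2 * (dA * dB))
    (hI : (N ^ 2 - 1) * I = r * (N * dA - dA ^ 2) + dB * (N * dA ^ 2 - dA))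
    (hε0 : 0 < ε) (hsmall : ε < 1 / 10 ^ 4) :
    1 / 8 * ε ≤ Real.sqrt (1 - ε ^ 2) * ε * (3 * r / 8 * (1 / r) - r / (32 * dA ^ 2) * I) := by
  have hN1 : 0 < N ^ 2 - 1 := by nlinarith
  have hrI : r * I ≤ 4 * dA ^ 2 := by
    have h2 : (N ^ 2 - 1) * (r * I)
        = N * (r * (r * dA)) + N * (N * dA ^ 2) - r * (r * dA ^ 2) - N * dA := by
      calc (N ^ 2 - 1) * (r * I) = r * ((N ^ 2 - 1) * I) := by ring
        _ = r * (r * (N * dA - dA ^ 2) + dB * (N * dA ^ 2 - dA)) := by rw [hI]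
        _ = r * (r * (N * dA - dA ^ 2)) + (r * dB) * (N * dA ^ 2 - dA) := by ring
        _ = _ := by rw [hNmul]; ring
    have h3 : 0 ≤ r * (r * dA ^ 2) := by positivity
    have h4 : 0 ≤ N * dA := by positivity
    have h5 : r * (r * dA) ≤ 2 * (N * dA ^ 2) := by
      calc r * (r * dA) ≤ r * (2 * (dA * dB) * dA) := by gcongr
        _ = 2 * ((r * dB) * dA ^ 2) := by ring
        _ = _ := by rw [hNmul]
    have h6 : N ^ 2 ≤ 4 / 3 * (N ^ 2 - 1) := by nlinarith
    have h8 : N * (r * (r * dA)) ≤ N * (2 * (N * dA ^ 2)) := by gcongr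
    have h9 := mul_le_mul_of_nonneg_left h6 (by positivity : (0 : ℝ) ≤ 3 * dA ^ 2)
    have h7 : (N ^ 2 - 1) * (r * I) ≤ (N ^ 2 - 1) * (4 * dA ^ 2) := by linarith
    exact le_of_mul_le_mul_left h7 hN1
  have h1 : 1 / 4 ≤ 3 * r / 8 * (1 / r) - r / (32 * dA ^ 2) * I := by
    have h2 : r / (32 * dA ^ 2) * I ≤ 1 / 8 := by
      rw [div_mul_eq_mul_div, div_le_iff₀ (by positivity)]
      linarith
    have h3 : 3 * r / 8 * (1 / r) = 3 / 8 := by field_simp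
    rw [h3]
    linarith
  have h2 : 1 / 2 ≤ Real.sqrt (1 - ε ^ 2) := by
    refine Real.le_sqrt_of_sq_le ?_
    nlinarith
  calc 1 / 8 * ε = 1 / 2 * ε * (1 / 4) := by ring
    _ ≤ Real.sqrt (1 - ε ^ 2) * ε * (1 / 4) := by gcongr
    _ ≤ _ := by gcongr

lemma continuous_traceOutB_apply (O : Matrix (Fin (r * dB)) (Fin (r * dB)) ℂ) (i j : Fin r) :
    Continuous fun U => traceOutB (conjBy O U) i j := by
  simp only [traceOutB, Matrix.of_apply]
  fun_prop

lemma integral_re_traceOutB_embedProj (hdB : 1 ≤ dB) (hle : dA ≤ r * dB) (i : Fin r) :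
    ∫ U, (traceOutB (conjBy (embedProj (r * dB) dA) U) i i).re ∂haarU (r * dB) = dA / r := by
  have h1 : ∫ U, traceOutB (conjBy (embedProj (r * dB) dA) U) i i ∂haarU (r * dB)
      = ((dA / r : ℝ) : ℂ) := by
    simp only [traceOutB, Matrix.of_apply]
    rw [integral_finsetSum _ fun y _ => integrable_haarU (by fun_prop)]
    simp only [integral_conjBy_apply, if_true, trace_embedProj hle]
    have : (dB : ℂ) ≠ 0 := by exact_mod_cast (by omega : dB ≠ 0)
    rw [Finset.sum_const, Finset.card_univ, Fintype.card_fin, nsmul_eq_mul]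
    push_cast
    field_simp
  have h2 := integral_re (𝕜 := ℂ)
    (integrable_haarU (continuous_traceOutB_apply (embedProj (r * dB) dA) i i))
  simp only [RCLike.re_eq_complex_re] at h2
  rw [h2, h1, Complex.ofReal_re]

lemma le_integral_prod_choiDist_flagIsometry (hdA : 1 ≤ dA) (hdB : 1 ≤ dB) (hr : 1 ≤ r)
    (hdim : (dA : ℝ) ≤ (r : ℝ) * dB / 2) {K : Fin r → Matrix (Fin dB) (Fin dA) ℂ}
    (hK : IsBalancedKraus K) {ε : ℝ} (hε0 : 0 < ε) (hsmall : ε < 1 / 10 ^ 4) :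
    1 / 8 * ε ≤ ∫ U, choiDist (flagIsometry K ε U.1) (flagIsometry K ε U.2)
      ∂((haarU (r * dB)).prod (haarU (r * dB))) := by
  have hdA1 : (1 : ℝ) ≤ dA := by exact_mod_cast hdA
  have hNR : (2 : ℝ) ≤ (r * dB : ℕ) := by push_cast; linarith
  have hN2 : 2 ≤ r * dB := by exact_mod_cast hNR
  have hle : dA ≤ r * dB := by
    have : (dA : ℝ) ≤ (r * dB : ℕ) := by push_cast; linarith
    exact_mod_cast this
  have hε1 : ε ≤ 1 := by linarith
  have hI := integral_frob_traceOutB hN2 (embedProj (r * dB) dA)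
  rw [frob_embedProj_sq hle, trace_embedProj hle, Complex.norm_natCast] at hI
  have hnum := flagIsometry_moment_bound hNR (by exact_mod_cast hr) hdA1
    (Nat.cast_mul r dB).symm (card_kraus_le hdA hr hK) hI hε0 hsmall
  have hcont : Continuous fun U : Matrix.unitaryGroup (Fin (r * dB)) ℂ ×
      Matrix.unitaryGroup (Fin (r * dB)) ℂ =>
      choiDist (flagIsometry K ε U.1) (flagIsometry K ε U.2) :=
    continuous_of_hsNorm_lipschitz _ fun U U' =>
      choiDist_flagIsometry_lipschitz hle hK hε0.le hε1 U.1 U.2 U'.1 U'.2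
  have hcT : ∀ i, Continuous fun U => frob (K i) ^ 2 / dA *
      ((dA : ℝ)⁻¹ * (traceOutB (conjBy (embedProj (r * dB) dA) U) i i).re) := fun i =>
    ((Complex.continuous_re.comp (continuous_traceOutB_apply _ i i)).const_mul _).const_mul _
  have hc1 := continuous_finsetSum Finset.univ fun i _ => hcT i
  have hc2 := continuous_frob_sq_traceOutB (embedProj (r * dB) dA)
  have hsec : ∀ U₁, Integrable (fun U₂ => choiDist (flagIsometry K ε U₁) (flagIsometry K ε U₂))
      (haarU (r * dB)) := fun U₁ =>
    integrable_section_haarU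
      (f := fun U₁ U₂ => choiDist (flagIsometry K ε U₁) (flagIsometry K ε U₂)) hcont U₁
  have hlow := integral_le_integral_prod_haarU
    (f := fun U₁ U₂ => choiDist (flagIsometry K ε U₁) (flagIsometry K ε U₂)) hcont
    (((hc1.const_mul (3 * r / 8)).sub (hc2.const_mul (r / (32 * dA ^ 2)))).const_mul
      (Real.sqrt (1 - ε ^ 2) * ε))
    fun U₁ => le_integral_choiDist_flagIsometry hdA hr hK hε0.le U₁ (hsec U₁)
  refine (hnum.trans (le_of_eq ?_)).trans hlow
  have hT1 : ∫ U, ∑ i, frob (K i) ^ 2 / dA *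
      ((dA : ℝ)⁻¹ * (traceOutB (conjBy (embedProj (r * dB) dA) U) i i).re) ∂haarU (r * dB)
        = 1 / r := by
    rw [integral_finsetSum _ fun i _ => integrable_haarU (hcT i)]
    simp only [integral_const_mul, integral_re_traceOutB_embedProj hdB hle]
    rw [← Finset.sum_mul, sum_krausWeight hdA hK]
    field_simp
  simp only [Pi.sub_apply]
  rw [integral_const_mul, integral_sub ((integrable_haarU hc1).const_mul _)
    ((integrable_haarU hc2).const_mul _), integral_const_mul, integral_const_mul, hT1]

end FlagFinal

end RandomChannel

theorem mainTheorem3 :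
    ∃ c : ℝ, 0 < c ∧
      (∀ (r dB : ℕ), 1 ≤ r → 1 ≤ dB →
        ∀ ε θ : ℝ, θ ∈ Set.Ioc (Real.pi / 2) Real.pi → ε = -2 * Real.cos θ →
          (∀ U₁ U₂ U₁' U₂' : Matrix.unitaryGroup (Fin (r * dB)) ℂ,
            |choiDist (conjIsometry r dB ε θ U₁)
                (conjIsometry r dB ε θ U₂)
              - choiDist (conjIsometry r dB ε θ U₁')
                (conjIsometry r dB ε θ U₂')|
            ≤ 4 * Real.sqrt (2 / ((r * dB : ℕ) : ℝ)) * ε *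
              Real.sqrt (hsNorm (U₁.1 - U₁'.1) ^ 2
                + hsNorm (U₂.1 - U₂'.1) ^ 2)) ∧
          (2 ≤ dB → ε < 1 / 10 ^ 4 →
            c * ε ≤ ∫ U, choiDist (conjIsometry r dB ε θ U.1)
                (conjIsometry r dB ε θ U.2)
              ∂((haarU (r * dB)).prod (haarU (r * dB))))) ∧
      (∀ (dA dB r : ℕ), 1 ≤ dA → 1 ≤ dB → 1 ≤ r → (dA : ℝ) ≤ (r : ℝ) * dB / 2 →
        ∀ K : Fin r → Matrix (Fin dB) (Fin dA) ℂ, IsBalancedKraus K →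
        ∀ ε : ℝ, 0 < ε → ε ≤ 1 →
          (∀ U₁ U₂ U₁' U₂' : Matrix.unitaryGroup (Fin (r * dB)) ℂ,
            |choiDist (flagIsometry K ε U₁)
                (flagIsometry K ε U₂)
              - choiDist (flagIsometry K ε U₁')
                (flagIsometry K ε U₂')|
            ≤ 4 * Real.sqrt (2 / (dA : ℝ)) * ε *
              Real.sqrt (hsNorm (U₁.1 - U₁'.1) ^ 2
                + hsNorm (U₂.1 - U₂'.1) ^ 2)) ∧
          (ε < 1 / 10 ^ 4 →
            c * ε ≤ ∫ U, choiDist (flagIsometry K ε U.1)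
                (flagIsometry K ε U.2)
              ∂((haarU (r * dB)).prod (haarU (r * dB))))) := by
  refine ⟨1 / 8, by norm_num, ?_, ?_⟩
  · intro r dB hr hdB ε θ hθ hε
    have hε0 : 0 < ε := by
      have h : Real.cos θ < 0 :=
        Real.cos_neg_of_pi_div_two_lt_of_lt hθ.1 (by linarith [hθ.2, Real.pi_pos])
      rw [hε]
      linarith
    exact ⟨choiDist_conjIsometry_lipschitz r dB hε0.le hε,
      fun h2 hs => le_integral_prod_choiDist_conjIsometry hr h2 hε0 hε hs⟩
  · intro dA dB r hdA hdB hr hdim K hK ε hε0 hε1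
    have hle : dA ≤ r * dB := by
      have h1 : (dA : ℝ) ≤ (r * dB : ℕ) := by
        push_cast
        have : (0 : ℝ) ≤ (r : ℝ) * dB := by positivity
        linarith
      exact_mod_cast h1
    exact ⟨choiDist_flagIsometry_lipschitz hle hK hε0.le hε1,
      fun hs => le_integral_prod_choiDist_flagIsometry hdA hdB hr hdim hK hε0 hs⟩
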